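/- Let $b$ be a prime, $m,s\in\mathbb{N}_0$, $N=b^m$, let $0\le w_1\le\dots\le w_s$ be integers (the reduction indices) and let $\gamma=(\gamma_{\mathfrak u})_{\mathfrak u\subseteq\{1,\dots,s\}}$ be arbitrary nonnegative weights. **Sobolev space.** $\mathcal W_{s,\gamma}$ is the weighted unanchored Sobolev space of functions $F$ on $[-\frac12,\frac12]^s$ which are square integrable together with all weak mixed first derivatives $\partial^{|\mathfrak u|}F/\partial y_{\mathfrak u}$, $\mathfrak u\subseteq\{1,\dots,s\}$, and for which the norm $$\|F\|_{\mathcal W_{s,\gamma}}=\Bigl(\sum_{\mathfrak u\subseteq\{1,\dots,s\}}\gamma_{\mathfrak u}^{-1}\int_{[-\frac12,\frac12]^{|\mathfrak u|}}\Bigl(\int_{[-\frac12,\frac12]^{s-|\mathfrak u|}}\frac{\partial^{|\mathfrak u|}F}{\partial y_{\mathfrak u}}(y_{\mathfrak u};y_{-\mathfrak u})\,dy_{-\mathfrak u}\Bigr)^2dy_{\mathfrak u}\Bigr)^{1/2}$$ is finite (with $1/0=\infty$, $\infty\cdot 0=0$). **Randomly shifted lattice rule.** For a generating vector $z\in\mathbb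 Z^s$ and a shift $\Delta$ uniformly distributed in $[0,1]^s$, $Q_N(F)=\frac1N\sum_{k=1}^N F\bigl(\{kz/N+\Delta\}-(\frac12,\dots,\frac12)\bigr)$, where $\{\cdot\}$ is the componentwise fractional part, and $I_s(F)=\int_{[-\frac12,\frac12]^s}F(y)\,dy$. **Korobov error.** For $d\le s$ and $z\in\mathbb Z^d$, let $e_{N,d}(z)$ be the worst-case error $\sup_f\bigl|\int_{[0,1]^d}f(x)\,dx-\frac1N\sum_{k=1}^N f(kz/N)\bigr|$ over all continuous $1$-periodic $f:\mathbb R^d\to\mathbb C$ with $\sum_{h\in\mathbb Z^d}\widetilde\gamma_{\mathfrak u(h)}^{-1}\prod_{j\in\mathfrak u(h)}|h_j|^2\,|\widehat f(h)|^2\le1$, where $\mathfrak u(h)=\{j:h_j\ne0\}$ and $\widetilde\gamma_{\mathfrak u}=\gamma_{\mathfrak u}/(2\pi^2)^{|\mathfrak u|}$; this is the unit ball of the Korobov space of smoothness $2$ with weights $\widetilde\gamma$. **Reduced CBC algorithm.** For $j=1,\dots,s$ with $w_j<m$ successively choose $z_j\in\{z\in\{0,\dots,b^{m-w_j}-1\}:\gcd(z,b^{m-w_j})=1\}$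 minimizing $z\mapsto e_{N,j}^2(b^{w_1}z_1,\dots,b^{w_{j-1}}z_{j-1},b^{w_j}z)$ over this set; for $w_j\ge m$ put $z_j=0$. The output is $\widetilde z=(b^{w_1}z_1,\dots,b^{w_s}z_s)$. **Theorem.** The algorithm has an output, and every possible output $\widetilde z$ (for any choice among several minimizers) has the following property. For all $F\in\mathcal W_{s,\gamma}$ the lattice rule with generating vector $\widetilde z$ satisfies, for all $\lambda\in(1/2,1]$, $$\sqrt{\mathbb E_{\Delta}\bigl[|I_s(F)-Q_N(F)|^2\bigr]}\le\Bigl(\sum_{\emptyset\ne\mathfrak u\subseteq\{1,\dots,s\}}\gamma_{\mathfrak u}^{\lambda}\,\varrho(\lambda)^{|\mathfrak u|}\,b^{\min\{m,\max_{j\in\mathfrak u}w_j\}}\Bigr)^{1/(2\lambda)}\Bigl(\frac2N\Bigr)^{1/(2\lambda)}\|F\|_{\mathcal W_{s,\gamma}},$$ where $\varrho(\lambda)=2\zeta(2\lambda)(2\pi^2)^{-\lambda}$, and the expectation on the left exists and is finite. -/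

import Mathlib

open MeasureTheory
open scoped ENNReal ContDiff

noncomputable section

namespace ReducedCBC

/-! ### The cube `[-1/2, 1/2]^ι` -/

/-- The closed cube `[-1/2, 1/2]^ι`. -/
def cube (ι : Type*) : Set (ι → ℝ) := Set.Icc (fun _ => -(1 / 2)) (fun _ => 1 / 2)

/-- The open cube `(-1/2, 1/2)^ι`. -/
def openCube (ι : Type*) : Set (ι → ℝ) := Set.univ.pi fun _ => Set.Ioo (-(1 / 2)) (1 / 2)

/-- Lebesgue measure on the closed cube. -/
def cubeMeasure (ι : Type*) [Fintype ι] : Measure (ι → ℝ) := volume.restrict (cube ι)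

/-! ### The weighted unanchored Sobolev space -/

/-- The classical mixed first partial derivative `∂^{|u|} φ / ∂ y_u`: one differentiation in each
of the coordinates in `u`. -/
def mixedPartial {s : ℕ} (u : Finset (Fin s)) (φ : (Fin s → ℝ) → ℝ) : (Fin s → ℝ) → ℝ :=
  (u.sort (· ≤ ·)).foldr (fun j g y => lineDeriv ℝ g y (Pi.single j 1)) φ

/-- `g` is square integrable on the cube and is a weak mixed first derivative of `F` with respect
to the variables in `u`. -/
def IsWeakMixedDeriv {s : ℕ} (F : (Fin s → ℝ) → ℝ) (u : Finset (Fin s))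
    (g : (Fin s → ℝ) → ℝ) : Prop :=
  MemLp g 2 (cubeMeasure (Fin s)) ∧
    ∀ φ : (Fin s → ℝ) → ℝ, ContDiff ℝ ∞ φ → HasCompactSupport φ →
      tsupport φ ⊆ openCube (Fin s) →
      ∫ y, F y * mixedPartial u φ y ∂(cubeMeasure (Fin s)) =
        (-1) ^ u.card * ∫ y, g y * φ y ∂(cubeMeasure (Fin s))

open Classical in
/-- The weak mixed derivative of `F` with respect to the variables in `u` (unique almost everywhere
on the cube; zero if there is none). -/
def weakMixedDeriv {s : ℕ} (F : (Fin s → ℝ) → ℝ) (u : Finset (Fin s)) : (Fin s → ℝ) → ℝ :=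
  if h : ∃ g, IsWeakMixedDeriv F u g then h.choose else 0

/-- The point `(y_u; y_{-u})` with the given coordinates in `u` and outside `u`. -/
def combine {s : ℕ} (u : Finset (Fin s)) (yu : {j // j ∈ u} → ℝ) (yc : {j // j ∉ u} → ℝ) :
    Fin s → ℝ :=
  fun j => if h : j ∈ u then yu ⟨j, h⟩ else yc ⟨j, h⟩

/-- The norm of the weighted unanchored Sobolev space, with values in `[0, ∞]`. For a zero weight
the usual conventions `1 / 0 = ∞` and `∞ * 0 = 0` apply. -/
def sobolevNorm {s : ℕ} (γ : Finset (Fin s) → ℝ) (F : (Fin s → ℝ) → ℝ) : ℝ≥0∞ :=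
  (∑ u : Finset (Fin s), (ENNReal.ofReal (γ u))⁻¹ *
    ∫⁻ yu, ‖∫ yc, weakMixedDeriv F u (combine u yu yc) ∂(cubeMeasure {j // j ∉ u})‖ₑ ^ 2
      ∂(cubeMeasure {j // j ∈ u})) ^ (1 / 2 : ℝ)

/-- Membership in the weighted unanchored Sobolev space: `F` and all its weak mixed first
derivatives are square integrable, and the norm is finite. -/
def MemSobolev {s : ℕ} (γ : Finset (Fin s) → ℝ) (F : (Fin s → ℝ) → ℝ) : Prop :=
  MemLp F 2 (cubeMeasure (Fin s)) ∧ (∀ u, ∃ g, IsWeakMixedDeriv F u g) ∧ sobolevNorm γ F < ⊤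

/-! ### Randomly shifted lattice rules -/

/-- The integral of `F` over the cube. -/
def cubeIntegral {s : ℕ} (F : (Fin s → ℝ) → ℝ) : ℝ := ∫ y, F y ∂(cubeMeasure (Fin s))

/-- The `N`-point rank-1 lattice rule on the cube with generating vector `z` and shift `Δ`. -/
def shiftedLatticeRule {s : ℕ} (N : ℕ) (z : Fin s → ℕ) (Δ : Fin s → ℝ) (F : (Fin s → ℝ) → ℝ) : ℝ :=
  (1 / (N : ℝ)) * ∑ k ∈ Finset.Icc 1 N,
    F (fun j => Int.fract ((k : ℝ) * (z j : ℝ) / (N : ℝ) + Δ j) - 1 / 2)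

/-- The squared integration error as a function of the shift. -/
def sqError {s : ℕ} (N : ℕ) (z : Fin s → ℕ) (F : (Fin s → ℝ) → ℝ) (Δ : Fin s → ℝ) : ℝ :=
  |cubeIntegral F - shiftedLatticeRule N z Δ F| ^ 2

/-- The root-mean-square error over a uniformly distributed shift in `[0, 1]^s`. -/
def rmse {s : ℕ} (N : ℕ) (z : Fin s → ℕ) (F : (Fin s → ℝ) → ℝ) : ℝ :=
  Real.sqrt (∫ Δ in Set.Icc (0 : Fin s → ℝ) 1, sqError N z F Δ)

/-! ### Lattice rules in the weighted Korobov space -/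

/-- The set of coordinates at which the frequency vector `h` does not vanish. -/
def freqSupport {d : ℕ} (h : Fin d → ℤ) : Finset (Fin d) := Finset.univ.filter fun j => h j ≠ 0

/-- The squared norm of the weighted Korobov space of smoothness `α`, with values in `[0, ∞]`
(conventions `1 / 0 = ∞` and `∞ * 0 = 0`). For `α > 1` the space consists of the continuous
1-periodic functions for which it is finite. -/
def korobovNormSq {d : ℕ} (α : ℝ) (γ : Finset (Fin d) → ℝ) (f : C(UnitAddTorus (Fin d), ℂ)) :
    ℝ≥0∞ :=
  ∑' h : Fin d → ℤ, (ENNReal.ofReal (γ (freqSupport h)))⁻¹ *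
    (∏ j ∈ freqSupport h, ENNReal.ofReal (|(h j : ℝ)| ^ α)) *
      ‖UnitAddTorus.mFourierCoeff f h‖ₑ ^ 2

/-- The integral of a periodic function over `[0, 1]^d`. -/
def periodIntegral {d : ℕ} (f : C(UnitAddTorus (Fin d), ℂ)) : ℂ :=
  ∫ x in Set.Icc (0 : Fin d → ℝ) 1, f (fun j => (x j : UnitAddCircle))

/-- The `N`-point rank-1 lattice rule with generating vector `z` for periodic functions. -/
def latticeRule {d : ℕ} (N : ℕ) (z : Fin d → ℕ) (f : C(UnitAddTorus (Fin d), ℂ)) : ℂ :=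
  (1 / (N : ℂ)) * ∑ k ∈ Finset.Icc 1 N,
    f (fun j => (((k : ℝ) * (z j : ℝ) / (N : ℝ) : ℝ) : UnitAddCircle))

/-- The worst-case error of the lattice rule over the unit ball of the Korobov space. -/
def korobovError {d : ℕ} (α : ℝ) (γ : Finset (Fin d) → ℝ) (N : ℕ) (z : Fin d → ℕ) : ℝ≥0∞ :=
  ⨆ (f : C(UnitAddTorus (Fin d), ℂ)) (_ : korobovNormSq α γ f ≤ 1),
    ‖periodIntegral f - latticeRule N z f‖ₑ

/-! ### The reduced component-by-component construction -/

/-- The units modulo `n`, as residues in `{0, …, n - 1}`; this is `{0}` for `n = 1`. -/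
def unitsMod (n : ℕ) : Finset ℕ := (Finset.range n).filter fun z => Nat.Coprime z n

/-- The generating vector `(b^{w_1} z_1, …, b^{w_s} z_s)`. -/
def genVector {s : ℕ} (b : ℕ) (w : Fin s → ℕ) (z : Fin s → ℕ) : Fin s → ℕ :=
  fun j => b ^ w j * z j

/-- The squared worst-case error of the lattice rule formed by the first components of `z`, up to
and including the component `j`, in the Korobov space over these coordinates. -/
def prefixErrorSq {s : ℕ} (α : ℝ) (γ : Finset (Fin s) → ℝ) (N : ℕ) (z : Fin s → ℕ) (j : Fin s) :
    ℝ≥0∞ :=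
  korobovError (d := j.val + 1) α
    (fun u => γ (u.map (Fin.castLEEmb j.isLt))) N (fun i => z (Fin.castLE j.isLt i)) ^ 2

/-- `(z_1, …, z_s)` is a possible outcome of the reduced CBC construction with `N = b^m` points,
reduction indices `w`, and Korobov worst-case error of smoothness `α` and weights `γ`:
components with `w_j < m` are successively selected among the units modulo `b^{m - w_j}` so as to
minimize the squared worst-case error, with arbitrary selection among several minimizers; the
remaining components are zero. -/
structure IsOutcome {s : ℕ} (b m : ℕ) (w : Fin s → ℕ) (α : ℝ) (γ : Finset (Fin s) → ℝ)
    (z : Fin s → ℕ) : Prop where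
  eq_zero : ∀ j, m ≤ w j → z j = 0
  mem_units : ∀ j, w j < m → z j ∈ unitsMod (b ^ (m - w j))
  minimal : ∀ j, w j < m → ∀ x ∈ unitsMod (b ^ (m - w j)),
    prefixErrorSq α γ (b ^ m) (genVector b w z) j ≤
      prefixErrorSq α γ (b ^ m) (genVector b w (Function.update z j x)) j

/-- The weights `γ_u / (2π²)^{|u|}` of the Korobov space (of smoothness 2) whose kernel is the
shift-averaged kernel of the unanchored Sobolev space with weights `γ_u`. -/
def korobovWeights {s : ℕ} (γ : Finset (Fin s) → ℝ) (u : Finset (Fin s)) : ℝ :=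
  γ u / (2 * Real.pi ^ 2) ^ u.card

/-- The constant `ϱ(λ) = 2 ζ(2λ) (2π²)^{-λ}`. -/
def rho (lam : ℝ) : ℝ :=
  2 * (riemannZeta ((2 * lam : ℝ) : ℂ)).re * (2 * Real.pi ^ 2) ^ (-lam)

end ReducedCBC

end

/-!
Averaging over the shift diagonalises the lattice rule in the Fourier basis of the cube, so the
mean square error is the sum of `|F̂(h)|²` over the nonzero `h` in the dual lattice. Integrating by
parts in the coordinates of the support `u` of `h`, against the antiderivatives of the exponentials
that vanish on the boundary of the cube, and applying the Cauchy-Schwarz inequality bounds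
`|F̂(h)|²` by `‖F‖² γ_u ∏_{j ∈ u} (2π² h_j²)⁻¹`. The sum of these weights over the dual lattice is
the squared worst-case error in the Korobov space.

It remains to bound this sum, raised to the power `λ`, for an output of the construction. By
Jensen's inequality `(∑ a)^λ ≤ ∑ a^λ` the frequencies may be grouped by their last nonzero
coordinate `d`. The component `z_d` was chosen to minimise the part belonging to `d`, which is
therefore at most its average over all units modulo `b^(m - w_d)`; for a fixed frequency, the
number of these units that put it into the dual lattice is controlled by the greatest common
divisor of `h_d` and `b^(m - w_d)`. The factor `2` in the bound comes from `b^n ≤ 2 φ(b^n)` for the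
number `φ(b^n)` of units.
-/

noncomputable section

namespace ReducedCBC

/-! ### Linear congruences -/

lemma card_range_filter_dvd_add_mul_le {M : ℕ} (hM : 0 < M) (a h : ℤ) :
    ((Finset.range M).filter fun x : ℕ => (M : ℤ) ∣ a + h * x).card ≤ Int.gcd h M := by
  set g := Int.gcd h M
  set K := M / g
  have hgM : K * g = M :=
    Nat.div_mul_cancel (by exact_mod_cast Int.gcd_dvd_right h (M : ℤ))
  have hK : 0 < K := Nat.pos_of_mul_pos_right (hgM ▸ hM)
  have hmod (x y : ℕ) (hx : (M : ℤ) ∣ a + h * x) (hy : (M : ℤ) ∣ a + h * y) : x ≡ y [MOD K] := by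
    have hxy : h * x ≡ h * y [ZMOD M] := by
      rw [Int.modEq_iff_dvd]
      simpa using dvd_sub hy hx
    have := hxy.cancel_left_div_gcd (by exact_mod_cast hM)
    rw [Int.gcd_comm] at this
    exact Int.natCast_modEq_iff.1 (by exact_mod_cast this)
  rw [← Finset.card_range g]
  refine Finset.card_le_card_of_injOn (fun x => x / K) (fun x hx => ?_) fun x hx y hy hxy => ?_
  · rw [Finset.mem_coe, Finset.mem_filter, Finset.mem_range] at hx
    rw [Finset.mem_coe, Finset.mem_range, Nat.div_lt_iff_lt_mul hK, mul_comm, hgM]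
    exact hx.1
  · rw [Finset.mem_coe, Finset.mem_filter] at hx hy
    rw [← Nat.div_add_mod x K, ← Nat.div_add_mod y K, hmod x y hx.2 hy.2]
    simp only at hxy
    rw [hxy]

lemma gcd_eq_gcd_of_dvd_add_mul {M : ℕ} {a h : ℤ} {x : ℕ} (hx : Nat.Coprime x M)
    (hdvd : (M : ℤ) ∣ a + h * x) : Int.gcd h M = Int.gcd a M := by
  obtain ⟨k, hk⟩ := hdvd
  calc Int.gcd h M = Int.gcd (h * x) M :=
        (Int.gcd_mul_left_left_of_gcd_eq_one (by simpa using hx)).symm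
    _ = Int.gcd a M := by
        rw [eq_sub_of_add_eq' hk, sub_eq_neg_add, Int.gcd_add_mul_left_left, Int.neg_gcd]

/-- The units `x` modulo `M` with `a + h x ≡ 0`: in a reduced CBC step, the choices of a component
for which a given frequency lies in the dual lattice. -/
def unitSolutions (M : ℕ) (a h : ℤ) : Finset ℕ :=
  (unitsMod M).filter fun x => (M : ℤ) ∣ a + h * x

lemma gcd_eq_of_unitSolutions_nonempty {M : ℕ} {a h : ℤ} (hne : (unitSolutions M a h).Nonempty) :
    Int.gcd h M = Int.gcd a M := by
  obtain ⟨x, hx⟩ := hne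
  simp only [unitSolutions, unitsMod, Finset.mem_filter] at hx
  exact gcd_eq_gcd_of_dvd_add_mul hx.1.2 hx.2

lemma card_unitSolutions_le {M : ℕ} (hM : 0 < M) (a h : ℤ) :
    (unitSolutions M a h).card ≤ Int.gcd a M := by
  rcases (unitSolutions M a h).eq_empty_or_nonempty with hempty | hne
  · simp [hempty]
  · rw [← gcd_eq_of_unitSolutions_nonempty hne]
    exact (Finset.card_le_card (Finset.filter_subset_filter _ (Finset.filter_subset _ _))).trans
      (card_range_filter_dvd_add_mul_le hM a h)

lemma unitsMod_one : unitsMod 1 = {0} := by simp [unitsMod, Finset.range_one]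

lemma card_unitsMod (n : ℕ) : (unitsMod n).card = n.totient := by
  simp_rw [unitsMod, Nat.totient_eq_card_coprime, Nat.coprime_comm]

lemma unitsMod_nonempty {n : ℕ} (hn : 0 < n) : (unitsMod n).Nonempty := by
  rw [← Finset.card_pos, card_unitsMod]
  exact Nat.totient_pos.2 hn

lemma le_two_mul_totient_of_prime {p : ℕ} (hp : p.Prime) : p ≤ 2 * p.totient := by
  have := hp.two_le
  rw [Nat.totient_prime hp]
  omega

lemma totient_pow_succ (b n : ℕ) : (b ^ (n + 1)).totient = b ^ n * b.totient := by
  induction n with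
  | zero => simp
  | succ n ih =>
    have hgcd := Nat.totient_gcd_mul_totient_mul (b ^ (n + 1)) b
    rw [Nat.gcd_eq_right (dvd_pow_self b n.succ_ne_zero), ← pow_succ] at hgcd
    rcases b.eq_zero_or_pos with rfl | hb
    · simp
    · refine Nat.eq_of_mul_eq_mul_left (Nat.totient_pos.2 hb) (hgcd.trans ?_)
      rw [ih]
      ring

lemma pow_le_mul_card_unitsMod {b : ℕ} (hb : 0 < b) {C : ℝ≥0∞}
    (hC : (b : ℝ≥0∞) ≤ C * b.totient) (n : ℕ) :
    ((b ^ n : ℕ) : ℝ≥0∞) ≤ C * (unitsMod (b ^ n)).card := by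
  rw [card_unitsMod]
  cases n with
  | zero =>
    have hb0 : (b : ℝ≥0∞) ≠ 0 := by exact_mod_cast hb.ne'
    have hbC : 1 * (b : ℝ≥0∞) ≤ C * b :=
      (one_mul _).trans_le (hC.trans (by gcongr; exact Nat.totient_le b))
    simpa using (ENNReal.mul_le_mul_iff_left hb0 (ENNReal.natCast_ne_top b)).1 hbC
  | succ n =>
    rw [totient_pow_succ, pow_succ, Nat.cast_mul, Nat.cast_mul, mul_left_comm]
    gcongr

/-! ### Sums over frequencies -/

lemma tsum_pi_prod_le {ι κ : Type*} [Fintype ι] (f : ι → κ → ℝ≥0∞) :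
    ∑' h : ι → κ, ∏ j, f j (h j) ≤ ∏ j, ∑' k, f j k := by
  classical
  rw [ENNReal.tsum_eq_iSup_sum]
  refine iSup_le fun S => ?_
  calc ∑ h ∈ S, ∏ j, f j (h j)
      ≤ ∑ h ∈ Fintype.piFinset fun j => S.image fun h => h j, ∏ j, f j (h j) :=
        Finset.sum_le_sum_of_subset fun h hh =>
          Fintype.mem_piFinset.2 fun j => Finset.mem_image_of_mem (fun h => h j) hh
    _ = ∏ j, ∑ k ∈ S.image fun h => h j, f j k := (Finset.prod_univ_sum _ _).symm
    _ ≤ ∏ j, ∑' k, f j k := Finset.prod_le_prod' fun j _ => ENNReal.sum_le_tsum _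

lemma rpow_sum_le_sum_rpow {κ : Type*} (S : Finset κ) (f : κ → ℝ≥0∞) {p : ℝ} (hp : 0 < p)
    (hp1 : p ≤ 1) : (∑ k ∈ S, f k) ^ p ≤ ∑ k ∈ S, f k ^ p :=
  Finset.le_sum_of_subadditive (· ^ p) (ENNReal.zero_rpow_of_pos hp).le
    (fun x y => ENNReal.rpow_add_le_add_rpow x y hp.le hp1) S f

lemma rpow_tsum_le_tsum_rpow {κ : Type*} (f : κ → ℝ≥0∞) {p : ℝ} (hp : 0 < p) (hp1 : p ≤ 1) :
    (∑' k, f k) ^ p ≤ ∑' k, f k ^ p := by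
  rw [← ENNReal.le_rpow_inv_iff hp, ENNReal.tsum_eq_iSup_sum]
  refine iSup_le fun S => (ENNReal.le_rpow_inv_iff hp).2 ?_
  exact (rpow_sum_le_sum_rpow S f hp hp1).trans (ENNReal.sum_le_tsum S)

/-- The decay `|k|^{-β}` in the Korobov space at a nonzero frequency `k` of one variable. It is set
to `0` at `k = 0`, since the factors at zero frequencies are collected in the weights. -/
def freqDecay (β : ℝ) (k : ℤ) : ℝ≥0∞ := if k = 0 then 0 else (ENNReal.ofReal (|(k : ℝ)| ^ β))⁻¹

lemma freqDecay_zero (β : ℝ) : freqDecay β 0 = 0 := if_pos rfl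

lemma freqDecay_of_ne_zero {β : ℝ} {k : ℤ} (hk : k ≠ 0) :
    freqDecay β k = ENNReal.ofReal (1 / |(k : ℝ)| ^ β) := by
  have : 0 < |(k : ℝ)| := abs_pos.2 (by exact_mod_cast hk)
  rw [freqDecay, if_neg hk, one_div, ENNReal.ofReal_inv_of_pos (by positivity)]

lemma freqDecay_neg (β : ℝ) (k : ℤ) : freqDecay β (-k) = freqDecay β k := by simp [freqDecay]

lemma freqDecay_ne_top (β : ℝ) (k : ℤ) : freqDecay β k ≠ ⊤ := by
  rcases eq_or_ne k 0 with rfl | hk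
  · simp [freqDecay_zero]
  · simp [freqDecay_of_ne_zero hk]

lemma freqDecay_ne_zero (β : ℝ) {k : ℤ} (hk : k ≠ 0) : freqDecay β k ≠ 0 := by
  simp [freqDecay, hk]

lemma freqDecay_rpow (β : ℝ) {lam : ℝ} (hlam : 0 < lam) (k : ℤ) :
    freqDecay β k ^ lam = freqDecay (β * lam) k := by
  rcases eq_or_ne k 0 with rfl | hk
  · simp [freqDecay_zero, hlam]
  · rw [freqDecay, freqDecay, if_neg hk, if_neg hk, ENNReal.inv_rpow,
      ENNReal.ofReal_rpow_of_nonneg (by positivity) hlam.le, Real.rpow_mul (abs_nonneg _)]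

lemma freqDecay_mul_le {β : ℝ} (hβ : 1 ≤ β) (g : ℕ) (k : ℤ) :
    freqDecay β (g * k) * g ≤ freqDecay β k := by
  rcases g.eq_zero_or_pos with rfl | hg
  · simp
  rcases eq_or_ne k 0 with rfl | hk
  · simp [freqDecay_zero]
  have hk' : 0 < |(k : ℝ)| := abs_pos.2 (by exact_mod_cast hk)
  have hg' : (0 : ℝ) < g := by exact_mod_cast hg
  have hg_le : (g : ℝ) ≤ (g : ℝ) ^ β := Real.self_le_rpow_of_one_le (by exact_mod_cast hg) hβ
  rw [freqDecay_of_ne_zero (mul_ne_zero (by exact_mod_cast hg.ne') hk), freqDecay_of_ne_zero hk,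
    ← ENNReal.ofReal_natCast, ← ENNReal.ofReal_mul (by positivity)]
  refine ENNReal.ofReal_le_ofReal ?_
  rw [Int.cast_mul, Int.cast_natCast, abs_mul, Nat.abs_cast,
    Real.mul_rpow hg'.le hk'.le, div_mul_eq_mul_div, one_mul,
    div_le_div_iff₀ (by positivity) (by positivity), one_mul]
  gcongr

lemma hasSum_riemannZeta_re {β : ℝ} (hβ : 1 < β) :
    HasSum (fun n : ℕ => 1 / ((n : ℝ) + 1) ^ β) (riemannZeta β).re := by
  have hsummable : Summable fun n : ℕ => 1 / ((n : ℝ) + 1) ^ β := by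
    simpa using (summable_nat_add_iff 1).2 (Real.summable_one_div_nat_rpow.2 hβ)
  have hterm (n : ℕ) : 1 / ((n : ℂ) + 1) ^ (β : ℂ) = ((1 / ((n : ℝ) + 1) ^ β : ℝ) : ℂ) := by
    rw [Complex.ofReal_div, Complex.ofReal_cpow (by positivity)]
    push_cast
    rfl
  rw [zeta_eq_tsum_one_div_nat_add_one_cpow (by simpa using hβ)]
  simp_rw [hterm]
  rw [← Complex.ofReal_tsum, Complex.ofReal_re]
  exact hsummable.hasSum

lemma riemannZeta_re_nonneg {β : ℝ} (hβ : 1 < β) : 0 ≤ (riemannZeta β).re :=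
  (hasSum_riemannZeta_re hβ).nonneg fun n => by positivity

lemma tsum_freqDecay {β : ℝ} (hβ : 1 < β) :
    ∑' k, freqDecay β k = ENNReal.ofReal (2 * (riemannZeta β).re) := by
  have hpos : ∑' n : ℕ, freqDecay β (n + 1) = ENNReal.ofReal (riemannZeta β).re := by
    rw [← (hasSum_riemannZeta_re hβ).tsum_eq, ENNReal.ofReal_tsum_of_nonneg
      (fun n => by positivity) (hasSum_riemannZeta_re hβ).summable]
    refine tsum_congr fun n => ?_
    rw [freqDecay_of_ne_zero (by omega)]
    push_cast
    rw [abs_of_nonneg (by positivity)]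
  rw [tsum_of_nat_of_neg_add_one (f := freqDecay β) ENNReal.summable ENNReal.summable,
    tsum_eq_zero_add' ENNReal.summable]
  simp_rw [freqDecay_neg]
  push_cast
  rw [hpos, freqDecay_zero, zero_add, two_mul, ENNReal.ofReal_add] <;>
    exact riemannZeta_re_nonneg hβ

lemma tsum_freqDecay_ne_top {β : ℝ} (hβ : 1 < β) : ∑' k, freqDecay β k ≠ ⊤ :=
  tsum_freqDecay hβ ▸ ENNReal.ofReal_ne_top

lemma sum_unitsMod_tsum_freqDecay_le {β : ℝ} (hβ : 1 ≤ β) {M : ℕ} (hM : 0 < M) (a : ℤ) :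
    ∑ x ∈ unitsMod M, ∑' k : ℤ, (if (M : ℤ) ∣ a + k * x then freqDecay β k else 0) ≤
      ∑' k, freqDecay β k := by
  set g := Int.gcd a M
  have hg : (g : ℤ) ≠ 0 := by exact_mod_cast Int.gcd_ne_zero_right (by exact_mod_cast hM.ne')
  have hcount (k : ℤ) : (∑ x ∈ unitsMod M, if (M : ℤ) ∣ a + k * x then freqDecay β k else 0) =
      (unitSolutions M a k).card * freqDecay β k := by
    rw [← Finset.sum_filter, Finset.sum_const, nsmul_eq_mul, unitSolutions]
  rw [← Summable.tsum_finsetSum fun _ _ => ENNReal.summable]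
  simp_rw [hcount]
  -- Only multiples `k = g q` contribute, each with at most `g` solutions.
  rw [← (mul_right_injective₀ hg).tsum_eq]
  · refine ENNReal.tsum_le_tsum fun q => le_trans ?_ (freqDecay_mul_le hβ g q)
    rw [mul_comm]
    gcongr
    exact card_unitSolutions_le hM a _
  · intro k hk
    have hne : (unitSolutions M a k).Nonempty := by
      rw [← Finset.card_ne_zero]
      intro hzero
      simp [hzero] at hk
    obtain ⟨q, hq⟩ := Int.gcd_dvd_left k (M : ℤ)
    exact ⟨q, by rw [hq, gcd_eq_of_unitSolutions_nonempty hne]⟩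

lemma sum_unitsMod_tsum_freqDecay_mul_le {β : ℝ} (hβ : 1 ≤ β) {q M : ℕ} (hq : 0 < q) (hM : 0 < M)
    (a : ℤ) :
    ∑ x ∈ unitsMod M,
        ∑' k : ℤ, (if ((q * M : ℕ) : ℤ) ∣ a + k * (q * x : ℕ) then freqDecay β k else 0) ≤
      ∑' k, freqDecay β k := by
  by_cases hqa : (q : ℤ) ∣ a
  · obtain ⟨a, rfl⟩ := hqa
    have hdvd (x : ℕ) (k : ℤ) :
        ((q * M : ℕ) : ℤ) ∣ q * a + k * (q * x : ℕ) ↔ (M : ℤ) ∣ a + k * x := by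
      push_cast
      rw [mul_left_comm, ← mul_add]
      exact mul_dvd_mul_iff_left (by exact_mod_cast hq.ne')
    simp_rw [hdvd]
    exact sum_unitsMod_tsum_freqDecay_le hβ hM a
  · have hdvd (x : ℕ) (k : ℤ) : ¬ ((q * M : ℕ) : ℤ) ∣ a + k * (q * x : ℕ) := fun h => hqa <| by
      push_cast at h
      rw [mul_left_comm] at h
      exact (dvd_add_left (dvd_mul_right _ _)).1 (dvd_of_mul_right_dvd h)
    simp only [hdvd, if_false, tsum_zero, Finset.sum_const_zero, zero_le]

/-- The dual lattice of the rank-1 lattice rule with generating vector `v`: the frequencies,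
including `0`, whose exponentials the rule does not average to `0`. -/
def dualLattice {ι : Type*} [Fintype ι] (N : ℕ) (v : ι → ℕ) : Set (ι → ℤ) :=
  {h | (N : ℤ) ∣ ∑ j, h j * v j}

section DecayProd

variable {ι : Type*} [Fintype ι] [DecidableEq ι]

/-- The product of the decays of `h j` for `j ∈ u`, as a function on all frequency vectors: it
vanishes unless the support of `h` is `u`. -/
def decayProd (β : ℝ) (u : Finset ι) (h : ι → ℤ) : ℝ≥0∞ :=
  ∏ j, if j ∈ u then freqDecay β (h j) else if h j = 0 then 1 else 0

lemma tsum_decayProd_le (β : ℝ) (u : Finset ι) :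
    ∑' h, decayProd β u h ≤ (∑' k, freqDecay β k) ^ u.card := by
  have hfactor (j : ι) : (∑' k, if j ∈ u then freqDecay β k else if k = 0 then 1 else 0) =
      if j ∈ u then ∑' k, freqDecay β k else 1 := by
    split_ifs <;> simp
  refine (tsum_pi_prod_le fun j k =>
    if j ∈ u then freqDecay β k else if k = 0 then 1 else 0).trans_eq ?_
  simp_rw [hfactor]
  rw [Fintype.prod_ite_mem, Finset.prod_const]

omit [Fintype ι] in
lemma funSplitAt_symm_self {α : Type*} (d : ι) (k : α) (r : {j // j ≠ d} → α) :
    (Equiv.funSplitAt d α).symm (k, r) d = k := by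
  simp [Equiv.funSplitAt, Equiv.piSplitAt]

omit [Fintype ι] in
lemma funSplitAt_symm_coe {α : Type*} (d : ι) (k : α) (r : {j // j ≠ d} → α) (j : {j // j ≠ d}) :
    (Equiv.funSplitAt d α).symm (k, r) j = r j := by
  simp [Equiv.funSplitAt, Equiv.piSplitAt, j.2]

lemma decayProd_funSplitAt_symm (β : ℝ) {u : Finset ι} {d : ι} (hd : d ∈ u) (k : ℤ)
    (r : {j // j ≠ d} → ℤ) :
    decayProd β u ((Equiv.funSplitAt d ℤ).symm (k, r)) =
      freqDecay β k * decayProd β (u.subtype (· ≠ d)) r := by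
  rw [decayProd, Fintype.prod_eq_mul_prod_subtype_ne _ d, if_pos hd]
  simp_rw [funSplitAt_symm_self, funSplitAt_symm_coe, decayProd, Finset.mem_subtype]

lemma funSplitAt_symm_mem_dualLattice_update {N : ℕ} {v : ι → ℕ} {d : ι} {y : ℕ} {k : ℤ}
    {r : {j // j ≠ d} → ℤ} :
    (Equiv.funSplitAt d ℤ).symm (k, r) ∈ dualLattice N (Function.update v d y) ↔
      (N : ℤ) ∣ (∑ j : {j // j ≠ d}, r j * v j) + k * y := by
  rw [dualLattice, Set.mem_ofPred_eq, Fintype.sum_eq_add_sum_subtype_ne _ d, add_comm]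
  have hne (j : {j // j ≠ d}) : Function.update v d y j = v j := Function.update_of_ne j.2 y v
  simp only [funSplitAt_symm_self, funSplitAt_symm_coe, Function.update_self, hne]

lemma sum_unitsMod_tsum_decayProd_le {β : ℝ} (hβ : 1 ≤ β) {q M : ℕ} (hq : 0 < q) (hM : 0 < M)
    (v : ι → ℕ) {u : Finset ι} {d : ι} (hd : d ∈ u) :
    ∑ x ∈ unitsMod M,
        ∑' h, (dualLattice (q * M) (Function.update v d (q * x))).indicator (decayProd β u) h ≤
      (∑' k, freqDecay β k) ^ u.card := by
  classical
  set Z := ∑' k, freqDecay β k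
  set u' := u.subtype (· ≠ d)
  set a : ({j // j ≠ d} → ℤ) → ℤ := fun r => ∑ j : {j // j ≠ d}, r j * v j
  have hsplit (x : ℕ) :
      ∑' h, (dualLattice (q * M) (Function.update v d (q * x))).indicator (decayProd β u) h =
        ∑' r, (∑' k : ℤ, if ((q * M : ℕ) : ℤ) ∣ a r + k * (q * x : ℕ) then freqDecay β k else 0) *
          decayProd β u' r := by
    rw [← (Equiv.funSplitAt d ℤ).symm.tsum_eq, ENNReal.tsum_prod', ENNReal.tsum_comm]
    refine tsum_congr fun r => ?_
    rw [← ENNReal.tsum_mul_right]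
    refine tsum_congr fun k => ?_
    simp only [Set.indicator_apply, funSplitAt_symm_mem_dualLattice_update,
      decayProd_funSplitAt_symm β hd, ite_mul, zero_mul, a, u']
  have hcard : u'.card + 1 = u.card := by
    rw [Finset.card_subtype, Finset.filter_ne', Finset.card_erase_add_one hd]
  simp_rw [hsplit]
  rw [← Summable.tsum_finsetSum fun _ _ => ENNReal.summable]
  simp_rw [← Finset.sum_mul]
  calc _ ≤ ∑' r, Z * decayProd β u' r :=
        ENNReal.tsum_le_tsum fun r =>
          mul_le_mul_left (sum_unitsMod_tsum_freqDecay_mul_le hβ hq hM (a r)) _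
    _ ≤ Z * Z ^ u'.card := by
        rw [ENNReal.tsum_mul_left]
        gcongr
        exact tsum_decayProd_le β u'
    _ = Z ^ u.card := by rw [← pow_succ', hcard]

end DecayProd

/-! ### The error sum over the dual lattice -/

section ErrorSum

variable {s : ℕ}

lemma mem_freqSupport {h : Fin s → ℤ} {j : Fin s} : j ∈ freqSupport h ↔ h j ≠ 0 := by
  simp [freqSupport]

lemma decayProd_freqSupport (β : ℝ) (h : Fin s → ℤ) :
    decayProd β (freqSupport h) h = ∏ j ∈ freqSupport h, freqDecay β (h j) := by
  rw [decayProd, ← Fintype.prod_ite_mem (freqSupport h)]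
  refine Fintype.prod_congr _ _ fun j => ?_
  split_ifs with hj h0
  · rfl
  · rfl
  · exact absurd (mem_freqSupport.2 h0) hj

lemma decayProd_eq_zero (β : ℝ) {u : Finset (Fin s)} {h : Fin s → ℤ} (hu : freqSupport h ≠ u) :
    decayProd β u h = 0 := by
  obtain ⟨j, hj⟩ : ∃ j, ¬ (h j ≠ 0 ↔ j ∈ u) := by
    by_contra! hcon
    exact hu (Finset.ext fun j => mem_freqSupport.trans (hcon j))
  refine Finset.prod_eq_zero (Finset.mem_univ j) ?_
  by_cases hju : j ∈ u <;> simp_all [freqDecay_zero]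

/-- The reciprocal of the weight of the frequency `h` in the squared Korobov norm. -/
def freqWeight (β : ℝ) (γ : Finset (Fin s) → ℝ) (h : Fin s → ℤ) : ℝ≥0∞ :=
  ENNReal.ofReal (γ (freqSupport h)) * ∏ j ∈ freqSupport h, freqDecay β (h j)

lemma freqWeight_rpow (β : ℝ) (γ : Finset (Fin s) → ℝ) (h : Fin s → ℤ) {lam : ℝ}
    (hlam : 0 < lam) :
    freqWeight β γ h ^ lam =
      ENNReal.ofReal (γ (freqSupport h)) ^ lam * decayProd (β * lam) (freqSupport h) h := by
  rw [decayProd_freqSupport, freqWeight, ENNReal.mul_rpow_of_nonneg _ _ hlam.le,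
    ← ENNReal.prod_rpow_of_nonneg hlam.le]
  simp_rw [freqDecay_rpow β hlam]

lemma freqWeight_rpow_eq_sum (β : ℝ) (γ : Finset (Fin s) → ℝ) {h : Fin s → ℤ} {lam : ℝ}
    (hlam : 0 < lam) {U : Finset (Finset (Fin s))} (hU : freqSupport h ∈ U) :
    freqWeight β γ h ^ lam = ∑ u ∈ U, ENNReal.ofReal (γ u) ^ lam * decayProd (β * lam) u h := by
  rw [freqWeight_rpow β γ h hlam, Finset.sum_eq_single_of_mem (freqSupport h) hU]
  intro u _ hu
  rw [decayProd_eq_zero _ hu.symm, mul_zero]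

lemma tsum_freqWeight_ne_top {β : ℝ} (hβ : 1 < β) (γ : Finset (Fin s) → ℝ) :
    ∑' h, freqWeight β γ h ≠ ⊤ := by
  have hexpand (h : Fin s → ℤ) :
      freqWeight β γ h = ∑ u, ENNReal.ofReal (γ u) * decayProd β u h := by
    simpa using freqWeight_rpow_eq_sum β γ one_pos (Finset.mem_univ (freqSupport h))
  simp_rw [hexpand]
  rw [Summable.tsum_finsetSum fun _ _ => ENNReal.summable]
  refine ENNReal.sum_ne_top.2 fun u _ => ?_
  rw [ENNReal.tsum_mul_left]
  exact ENNReal.mul_ne_top ENNReal.ofReal_ne_top <| ne_top_of_le_ne_top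
    (ENNReal.pow_ne_top (tsum_freqDecay_ne_top hβ)) (tsum_decayProd_le β u)

/-- The sum of the reciprocal Korobov weights over the dual lattice points in `A`. Over all nonzero
frequencies this is the squared worst-case error. -/
def dualSum (β : ℝ) (γ : Finset (Fin s) → ℝ) (N : ℕ) (v : Fin s → ℕ) (A : Set (Fin s → ℤ)) :
    ℝ≥0∞ :=
  ∑' h : ↥(A ∩ dualLattice N v), freqWeight β γ h

lemma dualSum_ne_top {β : ℝ} (hβ : 1 < β) (γ : Finset (Fin s) → ℝ) (N : ℕ) (v : Fin s → ℕ)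
    (A : Set (Fin s → ℤ)) : dualSum β γ N v A ≠ ⊤ :=
  ne_top_of_le_ne_top (tsum_freqWeight_ne_top hβ γ)
    (ENNReal.tsum_comp_le_tsum_of_injective Subtype.val_injective _)

lemma dualSum_union (β : ℝ) (γ : Finset (Fin s) → ℝ) (N : ℕ) (v : Fin s → ℕ)
    {A B : Set (Fin s → ℤ)} (hAB : Disjoint A B) :
    dualSum β γ N v (A ∪ B) = dualSum β γ N v A + dualSum β γ N v B := by
  rw [dualSum, Set.union_inter_distrib_right]
  exact ENNReal.summable.tsum_union_disjoint
    (hAB.mono Set.inter_subset_left Set.inter_subset_left) ENNReal.summable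

lemma dualSum_iUnion_le (β : ℝ) (γ : Finset (Fin s) → ℝ) (N : ℕ) (v : Fin s → ℕ)
    {κ : Type*} [Fintype κ] (A : κ → Set (Fin s → ℤ)) :
    dualSum β γ N v (⋃ i, A i) ≤ ∑ i, dualSum β γ N v (A i) := by
  rw [dualSum, Set.iUnion_inter]
  exact ENNReal.tsum_iUnion_le _ _

lemma dualSum_update (β : ℝ) (γ : Finset (Fin s) → ℝ) (N : ℕ) (v : Fin s → ℕ) {d : Fin s}
    {A : Set (Fin s → ℤ)} (hA : ∀ h ∈ A, h d = 0) (y : ℕ) :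
    dualSum β γ N (Function.update v d y) A = dualSum β γ N v A := by
  have hinter : A ∩ dualLattice N (Function.update v d y) = A ∩ dualLattice N v := by
    ext h
    refine and_congr_right fun hh => ?_
    have hterm (j : Fin s) : h j * (Function.update v d y j : ℤ) = h j * (v j : ℤ) := by
      rcases eq_or_ne j d with rfl | hj
      · rw [hA h hh, zero_mul, zero_mul]
      · rw [Function.update_of_ne hj]
    simp_rw [dualLattice, Set.mem_ofPred_eq, hterm]
  rw [dualSum, dualSum, hinter]

/-- The nonzero frequencies involving only the components up to and including `d`. -/
def prefixFreq (d : Fin s) : Set (Fin s → ℤ) := {h | h ≠ 0 ∧ ∀ j, d < j → h j = 0}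

/-- The frequencies whose last nonzero component is the component `d`. -/
def lastFreq (d : Fin s) : Set (Fin s → ℤ) := {h | h d ≠ 0 ∧ ∀ j, d < j → h j = 0}

lemma prefixFreq_inter_union_lastFreq (d : Fin s) :
    (prefixFreq d ∩ {h | h d = 0}) ∪ lastFreq d = prefixFreq d := by
  ext h
  have hne : h d ≠ 0 → h ≠ 0 := fun hd h0 => hd (by rw [h0, Pi.zero_apply])
  simp only [prefixFreq, lastFreq, Set.mem_union, Set.mem_inter_iff, Set.mem_ofPred_eq]
  tauto

lemma iUnion_lastFreq : ⋃ d : Fin s, lastFreq d = {h | h ≠ 0} := by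
  ext h
  simp only [Set.mem_iUnion, Set.mem_ofPred_eq]
  constructor
  · rintro ⟨d, hd, -⟩ rfl
    exact hd rfl
  · intro hne
    have hsupp : (freqSupport h).Nonempty := by
      obtain ⟨j, hj⟩ := Function.ne_iff.1 hne
      exact ⟨j, mem_freqSupport.2 hj⟩
    refine ⟨(freqSupport h).max' hsupp, mem_freqSupport.1 (Finset.max'_mem _ hsupp), fun j hj => ?_⟩
    by_contra hj0
    exact hj.not_ge (Finset.le_max' _ _ (mem_freqSupport.2 hj0))

/-- The sets of components whose last element is `d`. -/
def lastSets (d : Fin s) : Finset (Finset (Fin s)) :=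
  Finset.univ.filter fun u => d ∈ u ∧ ∀ j ∈ u, j ≤ d

lemma mem_of_mem_lastSets {d : Fin s} {u : Finset (Fin s)} (hu : u ∈ lastSets d) : d ∈ u :=
  (Finset.mem_filter.1 hu).2.1

lemma freqSupport_mem_lastSets {d : Fin s} {h : Fin s → ℤ} (hh : h ∈ lastFreq d) :
    freqSupport h ∈ lastSets d := by
  refine Finset.mem_filter.2 ⟨Finset.mem_univ _, mem_freqSupport.2 hh.1, fun j hj => ?_⟩
  by_contra hlt
  exact mem_freqSupport.1 hj (hh.2 j (not_le.1 hlt))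

lemma sum_lastSets {M : Type*} [AddCommMonoid M] (f : Finset (Fin s) → M) :
    ∑ d, ∑ u ∈ lastSets d, f u = ∑ u with u.Nonempty, f u := by
  have hdisj : (Set.univ : Set (Fin s)).PairwiseDisjoint lastSets := by
    refine fun d _ e _ hde => Finset.disjoint_left.2 fun u hd he => hde ?_
    exact le_antisymm ((Finset.mem_filter.1 he).2.2 d (mem_of_mem_lastSets hd))
      ((Finset.mem_filter.1 hd).2.2 e (mem_of_mem_lastSets he))
  rw [← Finset.sum_biUnion (by simpa using hdisj)]
  refine Finset.sum_congr (Finset.ext fun u => ?_) fun _ _ => rfl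
  simp only [Finset.mem_biUnion, Finset.mem_univ, true_and, Finset.mem_filter]
  constructor
  · rintro ⟨d, hd⟩
    exact ⟨d, mem_of_mem_lastSets hd⟩
  · intro hu
    exact ⟨u.max' hu, Finset.mem_filter.2
      ⟨Finset.mem_univ u, u.max'_mem hu, fun j hj => u.le_max' j hj⟩⟩

lemma dualSum_lastFreq_rpow_le (β : ℝ) (γ : Finset (Fin s) → ℝ) (N : ℕ) (v : Fin s → ℕ)
    (d : Fin s) {lam : ℝ} (hlam : 0 < lam) (hlam1 : lam ≤ 1) :
    dualSum β γ N v (lastFreq d) ^ lam ≤ ∑ u ∈ lastSets d, ENNReal.ofReal (γ u) ^ lam *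
      ∑' h, (dualLattice N v).indicator (decayProd (β * lam) u) h := by
  have hterm (h : ↥(lastFreq d ∩ dualLattice N v)) : freqWeight β γ h ^ lam =
      ∑ u ∈ lastSets d, ENNReal.ofReal (γ u) ^ lam *
        (dualLattice N v).indicator (decayProd (β * lam) u) h := by
    rw [freqWeight_rpow_eq_sum β γ hlam (freqSupport_mem_lastSets h.2.1)]
    simp_rw [Set.indicator_of_mem h.2.2]
  simp_rw [← ENNReal.tsum_mul_left]
  rw [← Summable.tsum_finsetSum fun _ _ => ENNReal.summable]
  refine (rpow_tsum_le_tsum_rpow _ hlam hlam1).trans ?_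
  simp_rw [hterm]
  exact ENNReal.tsum_comp_le_tsum_of_injective Subtype.val_injective
    fun h => ∑ u ∈ lastSets d, ENNReal.ofReal (γ u) ^ lam *
      (dualLattice N v).indicator (decayProd (β * lam) u) h

lemma card_unitsMod_mul_dualSum_lastFreq_rpow_le {β lam : ℝ} (hlam : 0 < lam) (hlam1 : lam ≤ 1)
    (hβ : 1 ≤ β * lam) (γ : Finset (Fin s) → ℝ) {q M : ℕ} (hq : 0 < q) (hM : 0 < M)
    (v : Fin s → ℕ) (d : Fin s)
    (hmin : ∀ x ∈ unitsMod M, dualSum β γ (q * M) v (lastFreq d) ≤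
      dualSum β γ (q * M) (Function.update v d (q * x)) (lastFreq d)) :
    (unitsMod M).card * dualSum β γ (q * M) v (lastFreq d) ^ lam ≤
      ∑ u ∈ lastSets d, ENNReal.ofReal (γ u) ^ lam * (∑' k, freqDecay (β * lam) k) ^ u.card := by
  rw [← nsmul_eq_mul]
  calc (unitsMod M).card • dualSum β γ (q * M) v (lastFreq d) ^ lam
      ≤ ∑ x ∈ unitsMod M, dualSum β γ (q * M) (Function.update v d (q * x)) (lastFreq d) ^ lam :=
        Finset.card_nsmul_le_sum _ _ _ fun x hx => ENNReal.rpow_le_rpow (hmin x hx) hlam.le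
    _ ≤ ∑ x ∈ unitsMod M, ∑ u ∈ lastSets d, ENNReal.ofReal (γ u) ^ lam *
          ∑' h, (dualLattice (q * M) (Function.update v d (q * x))).indicator
            (decayProd (β * lam) u) h :=
        Finset.sum_le_sum fun x _ => dualSum_lastFreq_rpow_le _ _ _ _ _ hlam hlam1
    _ ≤ _ := by
        rw [Finset.sum_comm]
        refine Finset.sum_le_sum fun u hu => ?_
        rw [← Finset.mul_sum]
        gcongr
        exact sum_unitsMod_tsum_decayProd_le hβ hq hM v (mem_of_mem_lastSets hu)

lemma genVector_update (b : ℕ) (w z : Fin s → ℕ) (d : Fin s) (x : ℕ) :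
    genVector b w (Function.update z d x) =
      Function.update (genVector b w z) d (b ^ w d * x) := by
  ext j
  rcases eq_or_ne j d with rfl | hj
  · simp [genVector]
  · simp [genVector, hj]

lemma dualSum_lastFreq_le_update {β : ℝ} (hβ : 1 < β) (γ : Finset (Fin s) → ℝ) (N : ℕ)
    (v : Fin s → ℕ) (d : Fin s) (y : ℕ)
    (hmin : dualSum β γ N v (prefixFreq d) ≤
      dualSum β γ N (Function.update v d y) (prefixFreq d)) :
    dualSum β γ N v (lastFreq d) ≤ dualSum β γ N (Function.update v d y) (lastFreq d) := by
  have hdisj : Disjoint (prefixFreq d ∩ {h | h d = 0}) (lastFreq d) :=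
    Set.disjoint_left.2 fun h h0 hlast => hlast.1 h0.2
  rw [← prefixFreq_inter_union_lastFreq, dualSum_union _ _ _ _ hdisj, dualSum_union _ _ _ _ hdisj,
    dualSum_update β γ N v (fun h hh => hh.2)] at hmin
  exact (ENNReal.add_le_add_iff_left (dualSum_ne_top hβ γ N v _)).1 hmin

lemma dualSum_lastFreq_rpow_le_of_minimal {b : ℕ} (hb : 0 < b) {C : ℝ≥0∞}
    (hC : (b : ℝ≥0∞) ≤ C * b.totient) {m : ℕ} {w z : Fin s → ℕ} {d : Fin s}
    (hzero : m ≤ w d → z d = 0) (γ : Finset (Fin s) → ℝ) {β lam : ℝ} (hlam : 0 < lam)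
    (hlam1 : lam ≤ 1) (hβ : 1 ≤ β * lam)
    (hmin : w d < m → ∀ x ∈ unitsMod (b ^ (m - w d)),
      dualSum β γ (b ^ m) (genVector b w z) (lastFreq d) ≤
        dualSum β γ (b ^ m) (genVector b w (Function.update z d x)) (lastFreq d)) :
    dualSum β γ (b ^ m) (genVector b w z) (lastFreq d) ^ lam ≤
      (∑ u ∈ lastSets d, ENNReal.ofReal (γ u) ^ lam * (∑' k, freqDecay (β * lam) k) ^ u.card) *
        ((b : ℝ≥0∞) ^ min m (w d) * (C / (b : ℝ≥0∞) ^ m)) := by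
  set q := b ^ min m (w d)
  set M := b ^ (m - w d)
  have hN : b ^ m = q * M := by rw [← pow_add]; congr 1; omega
  have hM : 0 < M := Nat.pow_pos hb
  have hcard := pow_le_mul_card_unitsMod hb hC (m - w d)
  have hupdate (x : ℕ) (hx : x ∈ unitsMod M) :
      dualSum β γ (q * M) (genVector b w z) (lastFreq d) ≤
        dualSum β γ (q * M) (Function.update (genVector b w z) d (q * x)) (lastFreq d) := by
    rcases lt_or_ge (w d) m with hlt | hge
    · have := hmin hlt x hx
      rwa [genVector_update, hN, ← min_eq_right hlt.le] at this
    · have hx0 : x = 0 := by simpa [M, Nat.sub_eq_zero_of_le hge, unitsMod_one] using hx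
      have hd : genVector b w z d = q * x := by rw [genVector, hzero hge, hx0]; rfl
      rw [← hd, Function.update_eq_self]
  have hsum := card_unitsMod_mul_dualSum_lastFreq_rpow_le hlam hlam1 hβ γ (Nat.pow_pos hb) hM
    (genVector b w z) d hupdate
  rw [← hN] at hsum
  have hb0 : (b : ℝ≥0∞) ^ m ≠ 0 := pow_ne_zero m (by exact_mod_cast hb.ne')
  have hbtop : (b : ℝ≥0∞) ^ m ≠ ⊤ := ENNReal.pow_ne_top (ENNReal.natCast_ne_top b)
  rw [← mul_div_assoc, ← mul_div_assoc, ENNReal.le_div_iff_mul_le (.inl hb0) (.inl hbtop)]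
  set D := dualSum β γ (b ^ m) (genVector b w z) (lastFreq d) ^ lam
  set S := ∑ u ∈ lastSets d, ENNReal.ofReal (γ u) ^ lam * (∑' k, freqDecay (β * lam) k) ^ u.card
  calc D * (b : ℝ≥0∞) ^ m = D * (q * (M : ℕ)) := by rw [← Nat.cast_pow, hN, Nat.cast_mul]
    _ ≤ D * (q * (C * (unitsMod M).card)) := by gcongr
    _ = ((unitsMod M).card * D) * (q * C) := by ring
    _ ≤ S * (q * C) := by gcongr
    _ = S * ((b : ℝ≥0∞) ^ min m (w d) * C) := by rw [Nat.cast_pow]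

lemma dualSum_rpow_le {b : ℕ} (hb : 0 < b) {C : ℝ≥0∞} (hC : (b : ℝ≥0∞) ≤ C * b.totient) {m : ℕ}
    {w z : Fin s → ℕ} (hzero : ∀ d, m ≤ w d → z d = 0) (γ : Finset (Fin s) → ℝ) {β lam : ℝ}
    (hβ1 : 1 < β) (hlam : 0 < lam) (hlam1 : lam ≤ 1) (hβ : 1 ≤ β * lam)
    (hmin : ∀ d, w d < m → ∀ x ∈ unitsMod (b ^ (m - w d)),
      dualSum β γ (b ^ m) (genVector b w z) (prefixFreq d) ≤
        dualSum β γ (b ^ m) (genVector b w (Function.update z d x)) (prefixFreq d)) :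
    dualSum β γ (b ^ m) (genVector b w z) {h | h ≠ 0} ^ lam ≤
      (∑ u : Finset (Fin s) with u.Nonempty, ENNReal.ofReal (γ u) ^ lam *
        (∑' k, freqDecay (β * lam) k) ^ u.card * (b : ℝ≥0∞) ^ min m (u.sup w)) *
        (C / (b : ℝ≥0∞) ^ m) := by
  have hlast (d : Fin s) (hd : w d < m) (x : ℕ) (hx : x ∈ unitsMod (b ^ (m - w d))) :
      dualSum β γ (b ^ m) (genVector b w z) (lastFreq d) ≤
        dualSum β γ (b ^ m) (genVector b w (Function.update z d x)) (lastFreq d) := by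
    have := hmin d hd x hx
    rw [genVector_update] at this ⊢
    exact dualSum_lastFreq_le_update hβ1 γ _ _ d _ this
  calc dualSum β γ (b ^ m) (genVector b w z) {h | h ≠ 0} ^ lam
      ≤ (∑ d, dualSum β γ (b ^ m) (genVector b w z) (lastFreq d)) ^ lam := by
        rw [← iUnion_lastFreq]
        gcongr
        exact dualSum_iUnion_le _ _ _ _ _
    _ ≤ ∑ d, dualSum β γ (b ^ m) (genVector b w z) (lastFreq d) ^ lam :=
        rpow_sum_le_sum_rpow _ _ hlam hlam1
    _ ≤ ∑ d, ∑ u ∈ lastSets d, ENNReal.ofReal (γ u) ^ lam *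
          (∑' k, freqDecay (β * lam) k) ^ u.card * (b : ℝ≥0∞) ^ min m (u.sup w) *
            (C / (b : ℝ≥0∞) ^ m) := by
        refine Finset.sum_le_sum fun d _ => (dualSum_lastFreq_rpow_le_of_minimal hb hC (hzero d) γ
          hlam hlam1 hβ (hlast d)).trans ?_
        rw [Finset.sum_mul]
        refine Finset.sum_le_sum fun u hu => ?_
        rw [← mul_assoc]
        gcongr
        · exact_mod_cast hb
        · exact Finset.le_sup (mem_of_mem_lastSets hu)
    _ = _ := by rw [sum_lastSets, Finset.sum_mul]

end ErrorSum

/-! ### Fourier analysis on the torus -/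

section Torus

/-- The circle carries its Haar probability measure, as in `UnitAddTorus.mFourierCoeff`. -/
local instance circleMeasureSpace : MeasureSpace UnitAddCircle := ⟨AddCircle.haarAddCircle⟩

local instance circleHaar : Measure.IsAddHaarMeasure (volume : Measure UnitAddCircle) :=
  inferInstanceAs (Measure.IsAddHaarMeasure AddCircle.haarAddCircle)

local instance circleProbability : IsProbabilityMeasure (volume : Measure UnitAddCircle) :=
  inferInstanceAs (IsProbabilityMeasure AddCircle.haarAddCircle)

open UnitAddTorus

section TrigPolynomial

variable {ι : Type*} [Fintype ι]

lemma mFourierCoeff_mFourier (m n : ι → ℤ) :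
    mFourierCoeff (mFourier m) n = if n = m then 1 else 0 := by
  rw [← orthonormal_iff_ite.1 (orthonormal_mFourier (d := ι)) n m, ContinuousMap.inner_toLp,
    mFourierCoeff]
  simp only [← mFourier_neg, smul_eq_mul, mul_comm]

lemma mFourierCoeff_sum {κ : Type*} (S : Finset κ) (c : κ → ℂ) (f : κ → C(UnitAddTorus ι, ℂ))
    (n : ι → ℤ) :
    mFourierCoeff (∑ i ∈ S, c i • f i : C(UnitAddTorus ι, ℂ)) n =
      ∑ i ∈ S, c i * mFourierCoeff (f i) n := by
  have hint (i : κ) : Integrable (fun t => mFourier (-n) t • f i t)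
      (volume : Measure (UnitAddTorus ι)) :=
    (mFourier (-n) • f i).continuous.integrable_of_hasCompactSupport
      (HasCompactSupport.of_compactSpace _)
  simp_rw [mFourierCoeff, ← integral_const_mul]
  rw [← integral_finsetSum _ fun i _ => (hint i).const_mul (c i)]
  simp [Finset.mul_sum, mul_left_comm]

/-- The trigonometric polynomial with coefficients `c` at the frequencies in `S`. -/
def trigPolynomial (S : Finset (ι → ℤ)) (c : (ι → ℤ) → ℂ) : C(UnitAddTorus ι, ℂ) :=
  ∑ h ∈ S, c h • mFourier h

lemma mFourierCoeff_trigPolynomial (S : Finset (ι → ℤ)) (c : (ι → ℤ) → ℂ)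
    (n : ι → ℤ) : mFourierCoeff (trigPolynomial S c) n = if n ∈ S then c n else 0 := by
  rw [trigPolynomial, mFourierCoeff_sum]
  simp [mFourierCoeff_mFourier]

end TrigPolynomial

section LatticePoint

variable {ι : Type*}

/-- The point with index `k` of the `N`-point rank-1 lattice with generating vector `z`, on the
torus. -/
def latticePoint (N : ℕ) (z : ι → ℕ) (k : ℕ) : UnitAddTorus ι :=
  fun j => (((k : ℝ) * (z j : ℝ) / (N : ℝ) : ℝ) : UnitAddCircle)

lemma mFourier_latticePoint [Fintype ι] (N : ℕ) (z : ι → ℕ) (k : ℕ) (h : ι → ℤ) :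
    mFourier h (latticePoint N z k) =
      (Complex.exp (2 * Real.pi * Complex.I / N) ^ ∑ j, h j * (z j : ℤ)) ^ k := by
  rw [← Complex.exp_int_mul, ← Complex.exp_nat_mul]
  simp only [mFourier, ContinuousMap.coe_mk, latticePoint, fourier_coe_apply]
  rw [← Complex.exp_sum]
  congr 1
  push_cast
  rw [Finset.sum_mul, Finset.mul_sum]
  exact Finset.sum_congr rfl fun j _ => by ring

lemma sum_Icc_pow_of_pow_eq_one {K : Type*} [Field K] [DecidableEq K] {q : K} {N : ℕ}
    (hq : q ^ N = 1) : ∑ k ∈ Finset.Icc 1 N, q ^ k = if q = 1 then (N : K) else 0 := by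
  split_ifs with h1
  · simp [h1]
  · rw [← Finset.Ico_succ_right_eq_Icc, Nat.succ_eq_succ, geom_sum_Ico h1 (by simp)]
    simp [pow_succ, hq]

open Classical in
lemma latticeAverage_mFourier [Fintype ι] {N : ℕ} (hN : 0 < N) (z : ι → ℕ) (h : ι → ℤ) :
    (1 / (N : ℂ)) * ∑ k ∈ Finset.Icc 1 N, mFourier h (latticePoint N z k) =
      if h ∈ dualLattice N z then 1 else 0 := by
  have hprim := Complex.isPrimitiveRoot_exp N hN.ne'
  have hpow (a : ℤ) : (Complex.exp (2 * Real.pi * Complex.I / N) ^ a) ^ N = 1 := by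
    rw [← zpow_natCast, zpow_comm, zpow_natCast, hprim.pow_eq_one, one_zpow]
  have hone : Complex.exp (2 * Real.pi * Complex.I / N) ^ (∑ j, h j * (z j : ℤ)) = 1 ↔
      h ∈ dualLattice N z := hprim.zpow_eq_one_iff_dvd _
  simp_rw [mFourier_latticePoint, sum_Icc_pow_of_pow_eq_one (hpow _)]
  by_cases hdual : h ∈ dualLattice N z
  · rw [if_pos (hone.2 hdual), if_pos hdual, one_div_mul_cancel (Nat.cast_ne_zero.2 hN.ne')]
  · rw [if_neg (mt hone.1 hdual), if_neg hdual, mul_zero]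

end LatticePoint

section Korobov

variable {s : ℕ}

lemma integral_torus_eq {ι E : Type*} [Fintype ι] [NormedAddCommGroup E] [NormedSpace ℝ E]
    (f : UnitAddTorus ι → E) (a : ι → ℝ) :
    ∫ x, f x = ∫ x in Set.Icc a (a + 1), f (fun i => (x i : UnitAddCircle)) := by
  rw [integral_preimage f a, volume_pi, ← setIntegral_congr_set Measure.univ_pi_Ioc_ae_eq_Icc]
  simp [Set.pi]

lemma periodIntegral_eq (f : C(UnitAddTorus (Fin s), ℂ)) :
    periodIntegral f = mFourierCoeff f 0 := by
  rw [mFourierCoeff, integral_torus_eq _ 0, periodIntegral]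
  simp [mFourier_zero]

lemma latticeRule_eq (N : ℕ) (z : Fin s → ℕ) (f : C(UnitAddTorus (Fin s), ℂ)) :
    latticeRule N z f = (1 / (N : ℂ)) * ∑ k ∈ Finset.Icc 1 N, f (latticePoint N z k) := rfl

lemma hasSum_latticeRule_sub_periodIntegral {N : ℕ} (hN : 0 < N) (z : Fin s → ℕ)
    {f : C(UnitAddTorus (Fin s), ℂ)} (hf : Summable (mFourierCoeff f)) :
    HasSum (({h | h ≠ 0} ∩ dualLattice N z).indicator (mFourierCoeff f))
      (latticeRule N z f - periodIntegral f) := by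
  classical
  have hrule : HasSum (fun h => mFourierCoeff f h * if h ∈ dualLattice N z then 1 else 0)
      (latticeRule N z f) := by
    rw [latticeRule_eq]
    refine ((hasSum_sum fun k (_ : k ∈ Finset.Icc 1 N) =>
      hasSum_mFourier_series_apply_of_summable hf (latticePoint N z k)).mul_left
        (1 / (N : ℂ))).congr_fun fun h => ?_
    simp_rw [← latticeAverage_mFourier hN, smul_eq_mul, ← Finset.mul_sum]
    ring
  have hzero : HasSum (fun h => if h = 0 then mFourierCoeff f h else 0) (periodIntegral f) := by
    rw [periodIntegral_eq]
    exact (hasSum_ite_eq 0 (mFourierCoeff f 0)).congr_fun fun h => by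
      by_cases h0 : h = 0 <;> simp [h0]
  refine (hrule.sub hzero).congr_fun fun h => ?_
  rcases eq_or_ne h 0 with rfl | h0
  · simp [dualLattice]
  · simp [Set.indicator_apply, h0]

/-! ### The worst-case error in the Korobov space -/

lemma tsum_sq_le_of_sq_le_mul {ι : Type*} {a r t : ι → ℝ≥0∞} (h : ∀ i, a i ^ 2 ≤ r i * t i) :
    (∑' i, a i) ^ 2 ≤ (∑' i, r i) * ∑' i, t i := by
  have hsqrt (x : ℝ≥0∞) : (x ^ (1 / 2 : ℝ)) ^ (2 : ℝ) = x := by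
    rw [← ENNReal.rpow_mul]; norm_num
  have hterm (i : ι) : a i ≤ r i ^ (1 / 2 : ℝ) * t i ^ (1 / 2 : ℝ) := by
    rw [← ENNReal.mul_rpow_of_nonneg _ _ (by norm_num), one_div,
      ENNReal.le_rpow_inv_iff two_pos]
    exact_mod_cast h i
  rw [← ENNReal.rpow_two, ← ENNReal.le_rpow_inv_iff two_pos, ← one_div,
    ENNReal.mul_rpow_of_nonneg _ _ (by norm_num), ENNReal.tsum_eq_iSup_sum]
  refine iSup_le fun S => ?_
  calc ∑ i ∈ S, a i ≤ ∑ i ∈ S, r i ^ (1 / 2 : ℝ) * t i ^ (1 / 2 : ℝ) :=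
        Finset.sum_le_sum fun i _ => hterm i
    _ ≤ (∑ i ∈ S, (r i ^ (1 / 2 : ℝ)) ^ (2 : ℝ)) ^ (1 / 2 : ℝ) *
        (∑ i ∈ S, (t i ^ (1 / 2 : ℝ)) ^ (2 : ℝ)) ^ (1 / 2 : ℝ) :=
        ENNReal.inner_le_Lp_mul_Lq S _ _ Real.HolderConjugate.two_two
    _ ≤ _ := by
        simp_rw [hsqrt]
        gcongr <;> exact ENNReal.sum_le_tsum _

lemma freqWeight_ne_top (α : ℝ) (γ : Finset (Fin s) → ℝ) (h : Fin s → ℤ) :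
    freqWeight α γ h ≠ ⊤ :=
  ENNReal.mul_ne_top ENNReal.ofReal_ne_top (ENNReal.prod_ne_top fun _ _ => freqDecay_ne_top _ _)

lemma freqWeight_inv (α : ℝ) (γ : Finset (Fin s) → ℝ) (h : Fin s → ℤ) :
    (freqWeight α γ h)⁻¹ = (ENNReal.ofReal (γ (freqSupport h)))⁻¹ *
      ∏ j ∈ freqSupport h, ENNReal.ofReal (|(h j : ℝ)| ^ α) := by
  have hne_zero : ∏ j ∈ freqSupport h, freqDecay α (h j) ≠ 0 :=
    Finset.prod_ne_zero_iff.2 fun j hj => freqDecay_ne_zero _ (mem_freqSupport.1 hj)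
  rw [freqWeight, ENNReal.mul_inv (Or.inr (ENNReal.prod_ne_top fun _ _ => freqDecay_ne_top _ _))
    (Or.inr hne_zero), ENNReal.prod_inv_distrib fun _ _ _ _ _ => Or.inr (freqDecay_ne_top _ _)]
  congr 1
  refine Finset.prod_congr rfl fun j hj => ?_
  rw [freqDecay, if_neg (mem_freqSupport.1 hj), inv_inv]

lemma korobovNormSq_eq (α : ℝ) (γ : Finset (Fin s) → ℝ) (f : C(UnitAddTorus (Fin s), ℂ)) :
    korobovNormSq α γ f = ∑' h, (freqWeight α γ h)⁻¹ * ‖mFourierCoeff f h‖ₑ ^ 2 := by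
  simp_rw [korobovNormSq, freqWeight_inv]

lemma le_mul_inv_mul {r c : ℝ≥0∞} (hr : r ≠ ⊤) (h : r⁻¹ * c ≠ ⊤) : c ≤ r * (r⁻¹ * c) := by
  rcases eq_or_ne r 0 with rfl | h0
  · rcases eq_or_ne c 0 with rfl | hc
    · simp
    · simp [ENNReal.top_mul hc] at h
  · rw [← mul_assoc, ENNReal.mul_inv_cancel h0 hr, one_mul]

section UpperBound

variable {α : ℝ} {γ : Finset (Fin s) → ℝ} {f : C(UnitAddTorus (Fin s), ℂ)}

lemma enorm_mFourierCoeff_sq_le (hf : korobovNormSq α γ f ≠ ⊤) (h : Fin s → ℤ) :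
    ‖mFourierCoeff f h‖ₑ ^ 2 ≤
      freqWeight α γ h * ((freqWeight α γ h)⁻¹ * ‖mFourierCoeff f h‖ₑ ^ 2) := by
  rw [korobovNormSq_eq] at hf
  exact le_mul_inv_mul (freqWeight_ne_top _ _ _) (ENNReal.ne_top_of_tsum_ne_top hf h)

lemma summable_mFourierCoeff (hα : 1 < α) (hf : korobovNormSq α γ f ≠ ⊤) :
    Summable (mFourierCoeff f) := by
  have hsq : (∑' h, ‖mFourierCoeff f h‖ₑ) ^ 2 ≠ ⊤ := by
    refine ne_top_of_le_ne_top (ENNReal.mul_ne_top (tsum_freqWeight_ne_top hα γ) hf) ?_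
    rw [korobovNormSq_eq]
    exact tsum_sq_le_of_sq_le_mul (enorm_mFourierCoeff_sq_le hf)
  exact Summable.of_enorm fun htop => hsq (by simp [htop])

lemma enorm_periodIntegral_sub_latticeRule_sq_le (hα : 1 < α) {N : ℕ} (hN : 0 < N)
    (z : Fin s → ℕ) (hf : korobovNormSq α γ f ≠ ⊤) :
    ‖periodIntegral f - latticeRule N z f‖ₑ ^ 2 ≤
      dualSum α γ N z {h | h ≠ 0} * korobovNormSq α γ f := by
  have herr := hasSum_latticeRule_sub_periodIntegral hN z (summable_mFourierCoeff hα hf)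
  calc ‖periodIntegral f - latticeRule N z f‖ₑ ^ 2
      ≤ (∑' h : ↥({h | h ≠ 0} ∩ dualLattice N z), ‖mFourierCoeff f h‖ₑ) ^ 2 := by
        rw [enorm_sub_rev, ← herr.tsum_eq, ← tsum_subtype]
        gcongr
        exact enorm_tsum_le_tsum_enorm
    _ ≤ _ := tsum_sq_le_of_sq_le_mul fun h => enorm_mFourierCoeff_sq_le hf h.1
    _ ≤ dualSum α γ N z {h | h ≠ 0} * korobovNormSq α γ f := by
        rw [dualSum, korobovNormSq_eq]
        gcongr
        exact ENNReal.tsum_comp_le_tsum_of_injective Subtype.val_injective _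

end UpperBound

lemma korobovError_sq_le {α : ℝ} (hα : 1 < α) (γ : Finset (Fin s) → ℝ) {N : ℕ} (hN : 0 < N)
    (z : Fin s → ℕ) : korobovError α γ N z ^ 2 ≤ dualSum α γ N z {h | h ≠ 0} := by
  rw [← ENNReal.rpow_two, ← ENNReal.le_rpow_inv_iff two_pos]
  refine iSup₂_le fun f hf => ?_
  rw [ENNReal.le_rpow_inv_iff two_pos, ENNReal.rpow_two]
  exact (enorm_periodIntegral_sub_latticeRule_sq_le hα hN z
    (ne_top_of_le_ne_top ENNReal.one_ne_top hf)).trans (mul_le_of_le_one_right' hf)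

lemma korobovNormSq_trigPolynomial (α : ℝ) (γ : Finset (Fin s) → ℝ) (S : Finset (Fin s → ℤ))
    (c : (Fin s → ℤ) → ℂ) :
    korobovNormSq α γ (trigPolynomial S c) = ∑ h ∈ S, (freqWeight α γ h)⁻¹ * ‖c h‖ₑ ^ 2 := by
  rw [korobovNormSq_eq, tsum_eq_sum (s := S) fun h hh => by
    simp [mFourierCoeff_trigPolynomial, hh]]
  refine Finset.sum_congr rfl fun h hh => ?_
  rw [mFourierCoeff_trigPolynomial, if_pos hh]

lemma latticeRule_trigPolynomial {N : ℕ} (hN : 0 < N) {z : Fin s → ℕ} {S : Finset (Fin s → ℤ)}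
    (hS : ↑S ⊆ dualLattice N z) (c : (Fin s → ℤ) → ℂ) :
    latticeRule N z (trigPolynomial S c) = ∑ h ∈ S, c h := by
  simp only [latticeRule_eq, trigPolynomial, ContinuousMap.coe_sum, Finset.sum_apply,
    ContinuousMap.coe_smul, Pi.smul_apply, smul_eq_mul]
  rw [Finset.sum_comm, Finset.mul_sum]
  refine Finset.sum_congr rfl fun h hh => ?_
  rw [← Finset.mul_sum, mul_left_comm, latticeAverage_mFourier hN, if_pos (hS hh), mul_one]

-- The extremal coefficients are the weights themselves: they turn Cauchy–Schwarz into equality.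
lemma sum_freqWeight_le_korobovError_sq (α : ℝ) (γ : Finset (Fin s) → ℝ) {N : ℕ} (hN : 0 < N)
    {z : Fin s → ℕ} {S : Finset (Fin s → ℤ)} (hS : ↑S ⊆ {h | h ≠ 0} ∩ dualLattice N z) :
    ∑ h ∈ S, freqWeight α γ h ≤ korobovError α γ N z ^ 2 := by
  set T := ∑ h ∈ S, freqWeight α γ h with hT
  have hT_top : T ≠ ⊤ := ENNReal.sum_ne_top.2 fun h _ => freqWeight_ne_top α γ h
  rcases eq_or_ne T 0 with hT_zero | hT_zero
  · simp [hT_zero]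
  have hT_sqrt : ENNReal.ofReal √T.toReal ^ 2 = T := by
    rw [← ENNReal.ofReal_pow (Real.sqrt_nonneg _), Real.sq_sqrt ENNReal.toReal_nonneg,
      ENNReal.ofReal_toReal hT_top]
  set c : (Fin s → ℤ) → ℝ := fun h => (freqWeight α γ h).toReal / √T.toReal
  have hc_sq (h : Fin s → ℤ) : ‖(c h : ℂ)‖ₑ ^ 2 = freqWeight α γ h ^ 2 / T := by
    rw [← ofReal_norm, Complex.norm_real, Real.norm_of_nonneg (by positivity),
      ENNReal.ofReal_div_of_pos (Real.sqrt_pos.2 (ENNReal.toReal_pos hT_zero hT_top)),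
      ENNReal.ofReal_toReal (freqWeight_ne_top _ _ _), div_eq_mul_inv, mul_pow,
      ← ENNReal.inv_pow, hT_sqrt, div_eq_mul_inv]
  have hnorm : korobovNormSq α γ (trigPolynomial S fun h => c h) ≤ 1 := by
    rw [korobovNormSq_trigPolynomial]
    calc ∑ h ∈ S, (freqWeight α γ h)⁻¹ * ‖(c h : ℂ)‖ₑ ^ 2
        ≤ ∑ h ∈ S, freqWeight α γ h / T := by
          refine Finset.sum_le_sum fun h _ => ?_
          rw [hc_sq, sq, mul_div_assoc, ← mul_assoc]
          exact mul_le_of_le_one_left' (ENNReal.inv_mul_le_one _)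
      _ = 1 := by
          simp_rw [div_eq_mul_inv]
          rw [← Finset.sum_mul, ← hT, ENNReal.mul_inv_cancel hT_zero hT_top]
  have hperiod : periodIntegral (trigPolynomial S fun h => c h) = 0 := by
    rw [periodIntegral_eq, mFourierCoeff_trigPolynomial,
      if_neg fun hmem => (hS (Finset.mem_coe.2 hmem)).1 rfl]
  have hrule : latticeRule N z (trigPolynomial S fun h => c h) = (√T.toReal : ℂ) := by
    rw [latticeRule_trigPolynomial hN (hS.trans Set.inter_subset_right), ← Complex.ofReal_sum,
      ← Finset.sum_div, ← ENNReal.toReal_sum fun h _ => freqWeight_ne_top α γ h, Real.div_sqrt]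
  calc T = ‖periodIntegral (trigPolynomial S fun h => c h) -
        latticeRule N z (trigPolynomial S fun h => c h)‖ₑ ^ 2 := by
        rw [hperiod, hrule, zero_sub, enorm_neg, ← ofReal_norm, Complex.norm_real,
          Real.norm_of_nonneg (Real.sqrt_nonneg _), hT_sqrt]
    _ ≤ korobovError α γ N z ^ 2 := by
        gcongr
        exact le_iSup₂_of_le _ hnorm le_rfl

theorem korobovError_sq {α : ℝ} (hα : 1 < α) (γ : Finset (Fin s) → ℝ) {N : ℕ} (hN : 0 < N)
    (z : Fin s → ℕ) : korobovError α γ N z ^ 2 = dualSum α γ N z {h | h ≠ 0} := by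
  refine le_antisymm (korobovError_sq_le hα γ hN z) ?_
  rw [dualSum, ENNReal.tsum_eq_iSup_sum]
  refine iSup_le fun S => ?_
  have hS : ↑(S.map (Function.Embedding.subtype _)) ⊆ {h | h ≠ 0} ∩ dualLattice N z := by
    rintro _ hh
    obtain ⟨x, _, rfl⟩ := Finset.mem_map.1 hh
    exact x.2
  simpa only [Finset.sum_map, Function.Embedding.subtype_apply] using
    sum_freqWeight_le_korobovError_sq α γ hN hS

section Extend

variable {d : ℕ} (e : Fin d ↪ Fin s)

lemma freqSupport_extend (h : Fin d → ℤ) :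
    freqSupport (Function.extend e h 0) = (freqSupport h).map e := by
  ext j
  simp only [mem_freqSupport, Finset.mem_map]
  by_cases hj : ∃ i, e i = j
  · obtain ⟨i, rfl⟩ := hj
    simp [e.injective.extend_apply]
  · rw [Function.extend_apply' _ _ _ hj]
    simp only [Pi.zero_apply, ne_eq, not_true_eq_false, false_iff]
    exact fun ⟨i, _, hi⟩ => hj ⟨i, hi⟩

lemma freqWeight_extend (α : ℝ) (γ : Finset (Fin s) → ℝ) (h : Fin d → ℤ) :
    freqWeight α γ (Function.extend e h 0) = freqWeight α (fun u => γ (u.map e)) h := by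
  rw [freqWeight, freqWeight, freqSupport_extend, Finset.prod_map]
  simp_rw [e.injective.extend_apply]

lemma sum_extend_mul (h : Fin d → ℤ) (g : Fin s → ℤ) :
    ∑ j, Function.extend e h 0 j * g j = ∑ i, h i * g (e i) := by
  rw [← Finset.sum_subset (Finset.subset_univ (Finset.univ.map e)), Finset.sum_map]
  · simp_rw [e.injective.extend_apply]
  · intro j _ hj
    rw [Function.extend_apply' _ _ _ (by simpa using hj), Pi.zero_apply, zero_mul]

lemma image_extend_inter_dualLattice (N : ℕ) (z : Fin s → ℕ) :
    (fun h => Function.extend e h 0) '' ({h | h ≠ 0} ∩ dualLattice N fun i => z (e i)) =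
      {h | h ≠ 0 ∧ ∀ j ∉ Set.range e, h j = 0} ∩ dualLattice N z := by
  have hext_zero : Function.extend e (0 : Fin d → ℤ) 0 = (0 : Fin s → ℤ) :=
    Function.extend_const e 0
  have hext_ne (h : Fin d → ℤ) : Function.extend e h 0 ≠ (0 : Fin s → ℤ) ↔ h ≠ 0 :=
    ((Function.extend_injective e.injective _).ne_iff' hext_zero)
  ext h
  constructor
  · rintro ⟨g, ⟨hg, hdual⟩, rfl⟩
    exact ⟨⟨(hext_ne g).2 hg, fun j hj => Function.extend_apply' _ _ _ hj⟩, by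
      simpa [dualLattice, sum_extend_mul] using hdual⟩
  · rintro ⟨⟨h0, hrange⟩, hdual⟩
    have hext : Function.extend e (h ∘ e) 0 = h := by
      funext j
      by_cases hj : j ∈ Set.range e
      · obtain ⟨i, rfl⟩ := hj
        exact e.injective.extend_apply _ _ _
      · rw [Function.extend_apply' _ _ _ hj, hrange j hj, Pi.zero_apply]
    refine ⟨h ∘ e, ⟨(hext_ne _).1 (hext.symm ▸ h0), ?_⟩, hext⟩
    rw [← hext] at hdual
    simpa [dualLattice, sum_extend_mul] using hdual

lemma dualSum_comp_embedding (α : ℝ) (γ : Finset (Fin s) → ℝ) (N : ℕ) (z : Fin s → ℕ) :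
    dualSum α (fun u => γ (u.map e)) N (fun i => z (e i)) {h | h ≠ 0} =
      dualSum α γ N z {h | h ≠ 0 ∧ ∀ j ∉ Set.range e, h j = 0} := by
  rw [dualSum, dualSum, ← image_extend_inter_dualLattice,
    tsum_image _ (Function.extend_injective e.injective _).injOn]
  simp_rw [freqWeight_extend]

end Extend

theorem prefixErrorSq_eq {α : ℝ} (hα : 1 < α) (γ : Finset (Fin s) → ℝ) {N : ℕ} (hN : 0 < N)
    (z : Fin s → ℕ) (d : Fin s) :
    prefixErrorSq α γ N z d = dualSum α γ N z (prefixFreq d) := by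
  have hrange (j : Fin s) : j ∉ Set.range (Fin.castLEEmb d.isLt) ↔ d < j := by
    rw [← Fin.val_fin_lt]
    simp [Fin.castLEEmb]
  have hcomp := dualSum_comp_embedding (Fin.castLEEmb d.isLt) α γ N z
  simp only [hrange] at hcomp
  rw [prefixErrorSq, korobovError_sq hα _ hN, prefixFreq, ← hcomp]
  rfl

end Korobov

/-! ### The mean square error over the shift -/

section CubeCoordinates

lemma restrict_Icc_eq_pi {ι : Type*} [Fintype ι] (a b : ι → ℝ) :
    (volume : Measure (ι → ℝ)).restrict (Set.Icc a b) =
      Measure.pi fun i => (volume : Measure ℝ).restrict (Set.Icc (a i) (b i)) := by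
  rw [volume_pi, ← Set.pi_univ_Icc, Measure.restrict_pi_pi]

lemma measurePreserving_coe_circle (a : ℝ) :
    MeasurePreserving (fun t : ℝ => (t : UnitAddCircle)) (volume.restrict (Set.Icc a (a + 1)))
      volume := by
  rw [← restrict_Ioc_eq_restrict_Icc]
  convert! UnitAddCircle.measurePreserving_mk a using 1
  simp [volume, AddCircle.haarAddCircle]

lemma measurePreserving_coe_torus {ι : Type*} [Fintype ι] :
    MeasurePreserving (fun (t : ι → ℝ) j => (t j : UnitAddCircle))
      (volume.restrict (Set.Icc (0 : ι → ℝ) 1)) volume := by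
  rw [restrict_Icc_eq_pi]
  refine measurePreserving_pi _ _ fun _ => ?_
  simpa using measurePreserving_coe_circle 0

/-- The coordinate in `[-1/2, 1/2)` of a point of the circle, with the origin of the circle at
`-1/2`. -/
def circleSection (x : UnitAddCircle) : ℝ := AddCircle.equivIco (1 : ℝ) 0 x - 1 / 2

lemma circleSection_coe (t : ℝ) : circleSection (t : UnitAddCircle) = Int.fract t - 1 / 2 := by
  rw [circleSection, AddCircle.coe_equivIco_mk_apply]; simp

lemma coe_circleSection (x : UnitAddCircle) :
    ((circleSection x + 1 / 2 : ℝ) : UnitAddCircle) = x := by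
  rw [circleSection, sub_add_cancel]
  exact (AddCircle.equivIco (1 : ℝ) 0).symm_apply_apply x

lemma measurePreserving_sub_half :
    MeasurePreserving (fun t : ℝ => t - 1 / 2) (volume.restrict (Set.Icc 0 1))
      (volume.restrict (Set.Icc (-(1 / 2)) (1 / 2))) := by
  have hpre : (fun t : ℝ => t - 1 / 2) ⁻¹' Set.Icc (-(1 / 2)) (1 / 2) = Set.Icc 0 1 := by
    rw [Set.preimage_sub_const_Icc]; norm_num
  rw [← hpre]
  exact (measurePreserving_sub_right volume (1 / 2 : ℝ)).restrict_preimage measurableSet_Icc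

lemma measurePreserving_circleSection :
    MeasurePreserving circleSection volume
      ((volume : Measure ℝ).restrict (Set.Icc (-(1 / 2)) (1 / 2))) := by
  have hmeas : Measurable circleSection :=
    (measurable_subtype_coe.comp (AddCircle.measurableEquivIco (1 : ℝ) 0).measurable).sub_const _
  have hcoe := measurePreserving_coe_circle 0
  have hcomp : (circleSection ∘ fun t : ℝ => (t : UnitAddCircle)) =ᵐ[volume.restrict (Set.Icc 0 1)]
      fun t => t - 1 / 2 := by
    rw [← restrict_Ico_eq_restrict_Icc]
    filter_upwards [ae_restrict_mem measurableSet_Ico] with t ht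
    rw [Function.comp_apply, circleSection_coe, Int.fract_eq_self.2 ht]
  refine ⟨hmeas, ?_⟩
  rw [← hcoe.map_eq, Measure.map_map hmeas hcoe.measurable, zero_add, Measure.map_congr hcomp]
  exact measurePreserving_sub_half.map_eq

/-- The coordinates in `[-1/2, 1/2)` of a point of the torus. -/
def torusSection {ι : Type*} (x : UnitAddTorus ι) : ι → ℝ := fun j => circleSection (x j)

lemma measurePreserving_torusSection {ι : Type*} [Fintype ι] :
    MeasurePreserving (torusSection (ι := ι)) volume (cubeMeasure ι) := by
  rw [cubeMeasure, cube, restrict_Icc_eq_pi]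
  exact measurePreserving_pi _ _ fun _ => measurePreserving_circleSection

lemma memLp_comp_torusSection {ι : Type*} [Fintype ι] {F : (ι → ℝ) → ℝ} {p : ℝ≥0∞}
    (hF : MemLp F p (cubeMeasure ι)) : MemLp (fun x => (F (torusSection x) : ℂ)) p :=
  hF.ofReal.comp_measurePreserving measurePreserving_torusSection

/-- The character `t ↦ exp (-2πin(t + 1/2))` of the interval `[-1/2, 1/2]`. -/
def shiftedExp (n : ℤ) (t : ℝ) : ℂ := fourier (-n) ((t + 1 / 2 : ℝ) : UnitAddCircle)

lemma continuous_shiftedExp (n : ℤ) : Continuous (shiftedExp n) :=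
  (fourier (-n)).continuous.comp ((AddCircle.continuous_mk' 1).comp (by fun_prop))

/-- The Fourier coefficients of the periodic extension of `F`, with the origin at the corner
`(-1/2, …, -1/2)` of the cube. -/
def cubeFourierCoeff {ι : Type*} [Fintype ι] (F : (ι → ℝ) → ℝ) (h : ι → ℤ) : ℂ :=
  ∫ y, (∏ j, shiftedExp (h j) (y j)) * (F y : ℂ) ∂(cubeMeasure ι)

lemma mFourierCoeff_comp_torusSection {ι : Type*} [Fintype ι] {F : (ι → ℝ) → ℝ}
    (hF : AEStronglyMeasurable F (cubeMeasure ι)) (h : ι → ℤ) :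
    mFourierCoeff (fun x : UnitAddTorus ι => (F (torusSection x) : ℂ)) h =
      cubeFourierCoeff F h := by
  have hcont : Continuous fun y : ι → ℝ => ∏ j, shiftedExp (h j) (y j) :=
    continuous_finsetProd _ fun j _ => (continuous_shiftedExp _).comp (continuous_apply j)
  rw [cubeFourierCoeff, ← measurePreserving_torusSection.map_eq,
    integral_map measurePreserving_torusSection.aemeasurable, mFourierCoeff]
  · simp only [mFourier, ContinuousMap.coe_mk, smul_eq_mul, shiftedExp, torusSection,
      coe_circleSection, Pi.neg_apply]
  · rw [measurePreserving_torusSection.map_eq]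
    exact hcont.aestronglyMeasurable.mul (Complex.continuous_ofReal.comp_aestronglyMeasurable hF)

end CubeCoordinates

section LatticeError

variable {ι : Type*} [Fintype ι]

lemma mFourier_add_apply (h : ι → ℤ) (x y : UnitAddTorus ι) :
    mFourier h (x + y) = mFourier h x * mFourier h y := by
  simp [mFourier, fourier_apply, AddCircle.toCircle_add, Finset.prod_mul_distrib]

lemma mFourierCoeff_translate (f : UnitAddTorus ι → ℂ) (p : UnitAddTorus ι) (h : ι → ℤ) :
    mFourierCoeff (fun x => f (x + p)) h = mFourier h p * mFourierCoeff f h := by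
  have hinv : mFourier h p * mFourier (-h) p = 1 := by
    rw [← mFourier_add, add_neg_cancel, mFourier_zero, ContinuousMap.one_apply]
  have hshift (x : UnitAddTorus ι) : mFourier (-h) x • f (x + p) =
      mFourier h p * (mFourier (-h) (x + p) • f (x + p)) := by
    rw [mFourier_add_apply, smul_eq_mul, smul_eq_mul]
    linear_combination (-(mFourier (-h) x * f (x + p))) * hinv
  unfold mFourierCoeff
  simp_rw [hshift]
  rw [integral_const_mul, integral_add_right_eq_self (fun x => mFourier (-h) x • f x)]

lemma mFourierCoeff_const (c : ℂ) (h : ι → ℤ) :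
    mFourierCoeff (fun _ : UnitAddTorus ι => c) h = if h = 0 then c else 0 := by
  have hone := mFourierCoeff_mFourier (0 : ι → ℤ) h
  unfold mFourierCoeff at hone ⊢
  simp only [mFourier_zero, ContinuousMap.one_apply, smul_eq_mul, mul_one] at hone ⊢
  rw [integral_mul_const, hone]
  simp

lemma integrable_mFourier_smul {f : UnitAddTorus ι → ℂ} (hf : Integrable f) (n : ι → ℤ) :
    Integrable fun x => mFourier n x • f x :=
  hf.bdd_mul (mFourier n).continuous.aestronglyMeasurable <| Filter.Eventually.of_forall fun x =>
    ((mFourier n).norm_coe_le_norm x).trans mFourier_norm.le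

/-- The error of the `N`-point rank-1 lattice rule with generating vector `z` for the translate
of `f` by `x`. -/
def latticeError (N : ℕ) (z : ι → ℕ) (f : UnitAddTorus ι → ℂ) (x : UnitAddTorus ι) : ℂ :=
  (1 / (N : ℂ)) * ∑ k ∈ Finset.Icc 1 N, f (x + latticePoint N z k) - mFourierCoeff f 0

lemma memLp_latticeError (N : ℕ) (z : ι → ℕ) {f : UnitAddTorus ι → ℂ} {p : ℝ≥0∞}
    (hf : MemLp f p) : MemLp (latticeError N z f) p :=
  ((memLp_finsetSum _ fun _ _ =>
    hf.comp_measurePreserving (measurePreserving_add_right volume _)).const_mul _).sub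
      (memLp_const _)

lemma mFourierCoeff_latticeError {N : ℕ} (hN : 0 < N) (z : ι → ℕ) {f : UnitAddTorus ι → ℂ}
    (hf : Integrable f) (h : ι → ℤ) :
    mFourierCoeff (latticeError N z f) h =
      ({h | h ≠ 0} ∩ dualLattice N z).indicator (mFourierCoeff f) h := by
  classical
  have hshift (k : ℕ) :=
    integrable_mFourier_smul (hf.comp_add_right (latticePoint N z k)) (-h)
  have hlinear : mFourierCoeff (latticeError N z f) h = (1 / (N : ℂ)) * ∑ k ∈ Finset.Icc 1 N,
      mFourierCoeff (fun x => f (x + latticePoint N z k)) h -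
        mFourierCoeff (fun _ : UnitAddTorus ι => mFourierCoeff f 0) h := by
    conv_rhs => unfold mFourierCoeff
    rw [← integral_finsetSum _ fun k _ => hshift k, ← integral_const_mul,
      ← integral_sub ((integrable_finsetSum _ fun k _ => hshift k).const_mul _)
        (integrable_mFourier_smul (integrable_const _) _)]
    refine integral_congr_ae (Filter.Eventually.of_forall fun x => ?_)
    simp only [latticeError, smul_eq_mul, Finset.mul_sum, mul_sub, mul_left_comm]
    rfl
  simp_rw [hlinear, mFourierCoeff_translate, ← Finset.sum_mul]
  rw [← mul_assoc, latticeAverage_mFourier hN, mFourierCoeff_const]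
  rcases eq_or_ne h 0 with rfl | h0
  · simp [dualLattice]
  · simp [Set.indicator_apply, h0]

lemma ofReal_integral_norm_sq {f : UnitAddTorus ι → ℂ} (hf : MemLp f 2) :
    ENNReal.ofReal (∫ x, ‖f x‖ ^ 2) = ∑' h, ‖mFourierCoeff f h‖ₑ ^ 2 := by
  have hparseval := hasSum_sq_mFourierCoeff (hf.toLp f)
  have hcoeff (h : ι → ℤ) : mFourierCoeff (hf.toLp f) h = mFourierCoeff f h :=
    integral_congr_ae (hf.coeFn_toLp.mono fun x hx => by simp only [hx])
  have hnorm : ∫ x, ‖(hf.toLp f) x‖ ^ 2 = ∫ x, ‖f x‖ ^ 2 :=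
    integral_congr_ae (hf.coeFn_toLp.mono fun x hx => by simp only [hx])
  simp_rw [hcoeff, hnorm] at hparseval
  rw [← hparseval.tsum_eq, ENNReal.ofReal_tsum_of_nonneg (fun h => by positivity)
    hparseval.summable]
  simp_rw [ENNReal.ofReal_pow (norm_nonneg _), ofReal_norm]

lemma ofReal_integral_norm_latticeError_sq {N : ℕ} (hN : 0 < N) (z : ι → ℕ)
    {f : UnitAddTorus ι → ℂ} (hf : MemLp f 2) :
    ENNReal.ofReal (∫ x, ‖latticeError N z f x‖ ^ 2) =
      ∑' h : ↥({h | h ≠ 0} ∩ dualLattice N z), ‖mFourierCoeff f h‖ₑ ^ 2 := by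
  classical
  rw [ofReal_integral_norm_sq (memLp_latticeError N z hf),
    tsum_subtype ({h | h ≠ 0} ∩ dualLattice N z) fun h => ‖mFourierCoeff f h‖ₑ ^ 2]
  refine tsum_congr fun h => ?_
  rw [mFourierCoeff_latticeError hN z (hf.integrable one_le_two), Set.indicator_apply,
    Set.indicator_apply]
  split_ifs <;> simp

end LatticeError

section SqError

variable {s : ℕ} {F : (Fin s → ℝ) → ℝ}

lemma mFourierCoeff_comp_torusSection_zero (hF : AEStronglyMeasurable F (cubeMeasure (Fin s))) :
    mFourierCoeff (fun x : UnitAddTorus (Fin s) => (F (torusSection x) : ℂ)) 0 =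
      cubeIntegral F := by
  simp [mFourierCoeff_comp_torusSection hF, cubeFourierCoeff, shiftedExp, cubeIntegral,
    integral_complex_ofReal]

lemma sqError_eq_norm_latticeError_sq (hF : AEStronglyMeasurable F (cubeMeasure (Fin s)))
    (N : ℕ) (z : Fin s → ℕ) (Δ : Fin s → ℝ) :
    sqError N z F Δ = ‖latticeError N z (fun x => (F (torusSection x) : ℂ))
      fun j => (Δ j : UnitAddCircle)‖ ^ 2 := by
  have hpoint (k : ℕ) :
      torusSection ((fun j => (Δ j : UnitAddCircle)) + latticePoint N z k) =
        fun j => Int.fract ((k : ℝ) * (z j : ℝ) / (N : ℝ) + Δ j) - 1 / 2 := by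
    funext j
    rw [torusSection, Pi.add_apply, latticePoint, ← AddCircle.coe_add, circleSection_coe, add_comm]
  have herror : latticeError N z (fun x => (F (torusSection x) : ℂ))
      (fun j => (Δ j : UnitAddCircle)) =
        ((shiftedLatticeRule N z Δ F - cubeIntegral F : ℝ) : ℂ) := by
    simp only [latticeError, hpoint, mFourierCoeff_comp_torusSection_zero hF, shiftedLatticeRule]
    push_cast
    rfl
  rw [herror, Complex.norm_real, Real.norm_eq_abs, abs_sub_comm, sqError]

lemma integrableOn_sqError (hF : MemLp F 2 (cubeMeasure (Fin s))) (N : ℕ) (z : Fin s → ℕ) :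
    IntegrableOn (sqError N z F) (Set.Icc (0 : Fin s → ℝ) 1) := by
  have herror := memLp_latticeError N z (memLp_comp_torusSection hF)
  rw [funext (sqError_eq_norm_latticeError_sq hF.aestronglyMeasurable N z)]
  refine measurePreserving_coe_torus.integrable_comp_of_integrable
    (g := fun x => ‖latticeError N z (fun x => (F (torusSection x) : ℂ)) x‖ ^ 2) ?_
  simpa using herror.integrable_norm_rpow two_ne_zero (by norm_num)

theorem ofReal_integral_sqError (hF : MemLp F 2 (cubeMeasure (Fin s))) {N : ℕ} (hN : 0 < N)
    (z : Fin s → ℕ) :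
    ENNReal.ofReal (∫ Δ in Set.Icc (0 : Fin s → ℝ) 1, sqError N z F Δ) =
      ∑' h : ↥({h | h ≠ 0} ∩ dualLattice N z), ‖cubeFourierCoeff F h‖ₑ ^ 2 := by
  have hfourier := ofReal_integral_norm_latticeError_sq hN z (memLp_comp_torusSection hF)
  rw [integral_torus_eq _ 0, zero_add] at hfourier
  simp_rw [sqError_eq_norm_latticeError_sq hF.aestronglyMeasurable,
    ← mFourierCoeff_comp_torusSection hF.aestronglyMeasurable]
  exact hfourier

end SqError

end Torus

/-! ### Approximation by test functions in one variable -/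

section TestFunction

open Filter Topology

variable {E : Type*} [NormedAddCommGroup E]

/-- Bounded pointwise convergence on `(-1/2, 1/2)`, the mode of convergence under which integrals
over the cube pass to the limit. -/
structure BoundedlyTendsto (f : ℕ → ℝ → E) (a : ℝ → E) : Prop where
  exists_bound : ∃ C, ∀ n, ∀ t ∈ Set.Ioo (-(1 / 2) : ℝ) (1 / 2), ‖f n t‖ ≤ C
  tendsto : ∀ t ∈ Set.Ioo (-(1 / 2) : ℝ) (1 / 2), Tendsto (fun n => f n t) atTop (𝓝 (a t))

namespace BoundedlyTendsto

variable {f g : ℕ → ℝ → E} {a b : ℝ → E}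

lemma of_continuous (ha : Continuous a) : BoundedlyTendsto (fun _ => a) a := by
  obtain ⟨C, hC⟩ := (isCompact_Icc (a := (-(1 / 2) : ℝ)) (b := 1 / 2)).exists_bound_of_continuousOn
    ha.continuousOn
  exact ⟨⟨C, fun _ t ht => hC t (Set.Ioo_subset_Icc_self ht)⟩, fun _ _ => tendsto_const_nhds⟩

lemma of_tendsto {c : ℕ → E} {l : E} (hc : Tendsto c atTop (𝓝 l)) :
    BoundedlyTendsto (fun n _ => c n) fun _ => l := by
  obtain ⟨C, hC⟩ := (Metric.isBounded_range_of_tendsto c hc).exists_norm_le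
  exact ⟨⟨C, fun n _ _ => hC _ (Set.mem_range_self n)⟩, fun _ _ => hc⟩

lemma sub (hf : BoundedlyTendsto f a) (hg : BoundedlyTendsto g b) :
    BoundedlyTendsto (fun n t => f n t - g n t) fun t => a t - b t := by
  obtain ⟨C, hC⟩ := hf.exists_bound
  obtain ⟨D, hD⟩ := hg.exists_bound
  exact ⟨⟨C + D, fun n t ht => (norm_sub_le _ _).trans (add_le_add (hC n t ht) (hD n t ht))⟩,
    fun t ht => (hf.tendsto t ht).sub (hg.tendsto t ht)⟩

variable [NormedSpace ℝ E]

lemma smul {χ : ℕ → ℝ → ℝ} {c : ℝ → ℝ} (hχ : BoundedlyTendsto χ c) (hf : BoundedlyTendsto f a) :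
    BoundedlyTendsto (fun n t => χ n t • f n t) fun t => c t • a t := by
  obtain ⟨C, hC⟩ := hχ.exists_bound
  obtain ⟨D, hD⟩ := hf.exists_bound
  refine ⟨⟨C * D, fun n t ht => ?_⟩, fun t ht => (hχ.tendsto t ht).smul (hf.tendsto t ht)⟩
  rw [norm_smul]
  exact mul_le_mul (hC n t ht) (hD n t ht) (norm_nonneg _) ((norm_nonneg _).trans (hC n t ht))

lemma tendsto_intervalIntegral (hf : BoundedlyTendsto f a) (hcont : ∀ n, Continuous (f n))
    {t : ℝ} (ht : t ∈ Set.Icc (-(1 / 2) : ℝ) (1 / 2)) :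
    Tendsto (fun n => ∫ x in (-(1 / 2))..t, f n x) atTop (𝓝 (∫ x in (-(1 / 2))..t, a x)) := by
  obtain ⟨C, hC⟩ := hf.exists_bound
  have hIoo : ∀ᵐ x : ℝ, x ∈ Set.uIoc (-(1 / 2)) t → x ∈ Set.Ioo (-(1 / 2) : ℝ) (1 / 2) := by
    have hne : ∀ᵐ x : ℝ, x ≠ 1 / 2 := by simp [ae_iff]
    filter_upwards [hne] with x hx hmem
    rw [Set.uIoc_of_le ht.1] at hmem
    exact ⟨hmem.1, lt_of_le_of_ne (hmem.2.trans ht.2) hx⟩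
  refine intervalIntegral.tendsto_integral_filter_of_dominated_convergence (fun _ => C)
    (Eventually.of_forall fun n => (hcont n).aestronglyMeasurable)
    (Eventually.of_forall fun n => ?_) intervalIntegrable_const ?_
  · filter_upwards [hIoo] with x hx hmem using hC n x (hx hmem)
  · filter_upwards [hIoo] with x hx hmem using hf.tendsto x (hx hmem)

lemma primitive (hf : BoundedlyTendsto f a) (hcont : ∀ n, Continuous (f n)) :
    BoundedlyTendsto (fun n t => ∫ x in (-(1 / 2))..t, f n x)
      fun t => ∫ x in (-(1 / 2))..t, a x := by
  obtain ⟨C, hC⟩ := hf.exists_bound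
  refine ⟨⟨C, fun n t ht => ?_⟩, fun t ht =>
    hf.tendsto_intervalIntegral hcont (Set.Ioo_subset_Icc_self ht)⟩
  have hC0 : 0 ≤ C := (norm_nonneg _).trans (hC n t ht)
  refine (intervalIntegral.norm_integral_le_of_norm_le_const (C := C) fun x hx => ?_).trans
    (mul_le_of_le_one_right hC0 ?_)
  · rw [Set.uIoc_of_le ht.1.le] at hx
    exact hC n x ⟨hx.1, hx.2.trans_lt ht.2⟩
  · rw [abs_of_nonneg (by linarith [ht.1])]
    linarith [ht.2]

end BoundedlyTendsto

variable [NormedSpace ℝ E]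

/-- The test functions on `(-1/2, 1/2)`, against which weak derivatives are tested. The condition
that the support is a compact subset of the interval is expressed by a radius `ρ < 1/2` outside of
which the function vanishes. -/
structure IsTestFunction (φ : ℝ → E) : Prop where
  contDiff : ContDiff ℝ ∞ φ
  exists_radius : ∃ ρ < (1 / 2 : ℝ), ∀ t, ρ ≤ |t| → φ t = 0

namespace IsTestFunction

variable {φ ψ : ℝ → E}

lemma tsupport_subset (hφ : IsTestFunction φ) : tsupport φ ⊆ Set.Ioo (-(1 / 2)) (1 / 2) := by
  obtain ⟨ρ, hρ, hzero⟩ := hφ.exists_radius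
  have hsupport : Function.support φ ⊆ Set.Icc (-ρ) ρ := fun t ht =>
    abs_le.1 (not_lt.1 fun hlt => ht (hzero t hlt.le))
  exact (closure_minimal hsupport isClosed_Icc).trans
    (Set.Icc_subset_Ioo (neg_lt_neg hρ) hρ)

lemma hasCompactSupport (hφ : IsTestFunction φ) : HasCompactSupport φ :=
  isCompact_Icc.of_isClosed_subset (isClosed_tsupport _)
    (hφ.tsupport_subset.trans Set.Ioo_subset_Icc_self)

lemma sub (hφ : IsTestFunction φ) (hψ : IsTestFunction ψ) :
    IsTestFunction fun t => φ t - ψ t := by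
  obtain ⟨ρ, hρ, hφ0⟩ := hφ.exists_radius
  obtain ⟨σ, hσ, hψ0⟩ := hψ.exists_radius
  refine ⟨hφ.contDiff.sub hψ.contDiff, max ρ σ, max_lt hρ hσ, fun t ht => ?_⟩
  rw [hφ0 t ((le_max_left _ _).trans ht), hψ0 t ((le_max_right _ _).trans ht), sub_zero]

lemma smul {χ : ℝ → ℝ} (hχ : IsTestFunction χ) {a : ℝ → E} (ha : ContDiff ℝ ∞ a) :
    IsTestFunction fun t => χ t • a t := by
  obtain ⟨ρ, hρ, hχ0⟩ := hχ.exists_radius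
  exact ⟨hχ.contDiff.smul ha, ρ, hρ, fun t ht => by rw [hχ0 t ht, zero_smul]⟩

lemma hasDerivAt_primitive [CompleteSpace E] (hφ : IsTestFunction φ) (t : ℝ) :
    HasDerivAt (fun t => ∫ x in (-(1 / 2))..t, φ x) (φ t) t :=
  hφ.contDiff.continuous.integral_hasStrictDerivAt _ t |>.hasDerivAt

lemma primitive [CompleteSpace E] (hφ : IsTestFunction φ)
    (hmean : ∫ x in (-(1 / 2) : ℝ)..(1 / 2), φ x = 0) :
    IsTestFunction fun t => ∫ x in (-(1 / 2))..t, φ x := by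
  obtain ⟨ρ, hρ, hφ0⟩ := hφ.exists_radius
  refine ⟨contDiff_infty_iff_deriv.2 ⟨fun t => (hφ.hasDerivAt_primitive t).differentiableAt, ?_⟩,
    ρ, hρ, fun t ht => ?_⟩
  · rw [funext fun t => (hφ.hasDerivAt_primitive t).deriv]
    exact hφ.contDiff
  have hzero {c d : ℝ} (h : ∀ x ∈ Set.uIcc c d, ρ ≤ |x|) : ∫ x in c..d, φ x = 0 := by
    rw [intervalIntegral.integral_congr (g := fun _ => 0) fun x hx => hφ0 x (h x hx),
      intervalIntegral.integral_zero]
  rcases le_abs.1 ht with hright | hleft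
  · rw [← intervalIntegral.integral_add_adjacent_intervals (b := 1 / 2)
      (hφ.contDiff.continuous.intervalIntegrable _ _)
      (hφ.contDiff.continuous.intervalIntegrable _ _), hmean, zero_add]
    exact hzero fun x hx => ((le_min hρ.le hright).trans hx.1).trans (le_abs_self x)
  · refine hzero fun x hx => le_trans ?_ (neg_le_abs x)
    exact le_neg_of_le_neg (hx.2.trans (max_le (neg_le_neg hρ.le) (le_neg_of_le_neg hleft)))

end IsTestFunction

/-- A sequence of smooth cutoff functions, supported in `(-1/2, 1/2)` and converging to `1` on this
interval. -/
def cutoff (n : ℕ) : ContDiffBump (0 : ℝ) where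
  rIn := 1 / 2 - 2 / (n + 5)
  rOut := 1 / 2 - 1 / (n + 5)
  rIn_pos := by
    have : (2 : ℝ) / (n + 5) < 1 / 2 := by
      rw [div_lt_div_iff₀ (by positivity) (by norm_num)]
      linarith [(n.cast_nonneg : (0 : ℝ) ≤ n)]
    linarith
  rIn_lt_rOut := by
    have : (1 : ℝ) / (n + 5) < 2 / (n + 5) := by gcongr; norm_num
    linarith

lemma rOut_cutoff_lt (n : ℕ) : (cutoff n).rOut < 1 / 2 :=
  sub_lt_self _ (by positivity)

lemma isTestFunction_cutoff (n : ℕ) : IsTestFunction (cutoff n) :=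
  ⟨(cutoff n).contDiff, _, rOut_cutoff_lt n, fun _ ht =>
    (cutoff n).zero_of_le_dist (by simpa using ht)⟩

lemma isTestFunction_normed_cutoff (n : ℕ) : IsTestFunction ((cutoff n).normed volume) :=
  ⟨(cutoff n).contDiff_normed, _, rOut_cutoff_lt n, fun t ht => by
    rw [(cutoff n).normed_def, (cutoff n).zero_of_le_dist (by simpa using ht), zero_div]⟩

lemma intervalIntegral_normed_cutoff (n : ℕ) :
    ∫ x in (-(1 / 2) : ℝ)..(1 / 2), (cutoff n).normed volume x = 1 := by
  rw [intervalIntegral.integral_of_le (by norm_num)]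
  refine Eq.trans ?_ ((cutoff n).integral_normed (μ := volume))
  refine setIntegral_eq_integral_of_forall_compl_eq_zero fun t ht => ?_
  refine Function.notMem_support.1 fun hsupport => ht (Set.Ioo_subset_Ioc_self ?_)
  exact (isTestFunction_normed_cutoff n).tsupport_subset (subset_tsupport _ hsupport)

lemma boundedlyTendsto_cutoff : BoundedlyTendsto (fun n => cutoff n) fun _ => 1 := by
  refine ⟨⟨1, fun n t _ => ?_⟩, fun t ht => ?_⟩
  · rw [Real.norm_of_nonneg (cutoff n).nonneg]
    exact (cutoff n).le_one
  have hrIn : Tendsto (fun n : ℕ => (1 : ℝ) / 2 - 2 / (n + 5)) atTop (𝓝 (1 / 2)) := by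
    simpa only [sub_zero] using (tendsto_const_nhds (x := (1 / 2 : ℝ))).sub
      (tendsto_const_nhds.div_atTop
        (tendsto_atTop_add_const_right _ (5 : ℝ) tendsto_natCast_atTop_atTop))
  refine tendsto_const_nhds.congr' ?_
  filter_upwards [hrIn.eventually (lt_mem_nhds (abs_lt.2 ht))] with n hn
  exact ((cutoff n).one_of_mem_closedBall (by simpa [cutoff] using hn.le)).symm

lemma exists_isTestFunction_boundedlyTendsto {a : ℝ → E} (ha : ContDiff ℝ ∞ a) :
    ∃ φ : ℕ → ℝ → E, (∀ n, IsTestFunction (φ n)) ∧ BoundedlyTendsto φ a :=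
  ⟨fun n t => cutoff n t • a t, fun n => (isTestFunction_cutoff n).smul ha, by
    simpa only [one_smul] using boundedlyTendsto_cutoff.smul (.of_continuous ha.continuous)⟩

lemma exists_isTestFunction_integral_eq_zero [CompleteSpace E] {a : ℝ → E} (ha : ContDiff ℝ ∞ a)
    (hmean : ∫ x in (-(1 / 2) : ℝ)..(1 / 2), a x = 0) :
    ∃ φ : ℕ → ℝ → E, (∀ n, IsTestFunction (φ n)) ∧
      (∀ n, ∫ x in (-(1 / 2) : ℝ)..(1 / 2), φ n x = 0) ∧ BoundedlyTendsto φ a := by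
  obtain ⟨φ, hφ, hlim⟩ := exists_isTestFunction_boundedlyTendsto ha
  set η := (cutoff 0).normed volume
  have hη : IsTestFunction η := isTestFunction_normed_cutoff 0
  set c : ℕ → E := fun n => ∫ x in (-(1 / 2) : ℝ)..(1 / 2), φ n x
  have hc : Tendsto c atTop (𝓝 0) := hmean ▸
    hlim.tendsto_intervalIntegral (fun n => (hφ n).contDiff.continuous) (by norm_num)
  refine ⟨fun n t => φ n t - η t • c n, fun n => (hφ n).sub (hη.smul contDiff_const), fun n => ?_,
    ?_⟩
  · rw [intervalIntegral.integral_sub ((hφ n).contDiff.continuous.intervalIntegrable _ _)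
      ((hη.smul contDiff_const).contDiff.continuous.intervalIntegrable _ _),
      intervalIntegral.integral_smul_const, intervalIntegral_normed_cutoff, one_smul, sub_self]
  · simpa only [smul_zero, sub_zero] using
      hlim.sub (.smul (.of_continuous hη.contDiff.continuous) (.of_tendsto hc))

/-- `A` is a bounded limit of test functions `φ n`, while `a` is one of the derivatives of the
`φ n` if `d` holds, and of the `φ n` themselves otherwise. This is what is needed in a single
variable to integrate by parts against a product, where `d` says whether one differentiates with
respect to this variable. -/
def HasTestApprox (d : Prop) [Decidable d] (a A : ℝ → E) : Prop :=
  ∃ φ : ℕ → ℝ → E, (∀ n, IsTestFunction (φ n)) ∧ BoundedlyTendsto φ A ∧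
    BoundedlyTendsto (fun n => if d then deriv (φ n) else φ n) a

variable {d : Prop} [Decidable d]

lemma hasTestApprox_of_not (hd : ¬d) {a : ℝ → E} (ha : ContDiff ℝ ∞ a) : HasTestApprox d a a := by
  obtain ⟨φ, hφ, hlim⟩ := exists_isTestFunction_boundedlyTendsto ha
  exact ⟨φ, hφ, hlim, by simpa only [if_neg hd] using hlim⟩

lemma hasTestApprox_of_hasDerivAt [CompleteSpace E] (hd : d) {a A : ℝ → E} (ha : ContDiff ℝ ∞ a)
    (hderiv : ∀ t, HasDerivAt A (a t) t) (hleft : A (-(1 / 2)) = 0) (hright : A (1 / 2) = 0) :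
    HasTestApprox d a A := by
  have hA (t : ℝ) : ∫ x in (-(1 / 2))..t, a x = A t := by
    rw [intervalIntegral.integral_eq_sub_of_hasDerivAt (fun x _ => hderiv x)
      (ha.continuous.intervalIntegrable _ _), hleft, sub_zero]
  obtain ⟨φ, hφ, hmean, hlim⟩ := exists_isTestFunction_integral_eq_zero ha
    ((hA (1 / 2)).trans hright)
  have hderiv_primitive (n : ℕ) : deriv (fun t => ∫ x in (-(1 / 2))..t, φ n x) = φ n :=
    funext fun t => ((hφ n).hasDerivAt_primitive t).deriv
  refine ⟨fun n t => ∫ x in (-(1 / 2))..t, φ n x, fun n => (hφ n).primitive (hmean n), ?_, ?_⟩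
  · simpa only [hA] using hlim.primitive fun n => (hφ n).contDiff.continuous
  · simpa only [if_pos hd, hderiv_primitive] using hlim

end TestFunction

/-! ### Integration by parts against products -/

section IntegrationByParts

open Filter Topology

variable {ι : Type*} [Fintype ι] {s : ℕ} {F g : (Fin s → ℝ) → ℝ} {u : Finset (Fin s)}

instance (ι : Type*) [Fintype ι] : IsFiniteMeasure (cubeMeasure ι) :=
  isFiniteMeasure_restrict.2 isCompact_Icc.measure_ne_top

lemma ae_mem_openCube : ∀ᵐ y ∂(cubeMeasure ι), y ∈ openCube ι := by
  have hcube : (openCube ι : Set (ι → ℝ)) =ᵐ[volume] cube ι :=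
    Measure.univ_pi_Ioo_ae_eq_Icc (μ := fun _ => volume)
  rw [cubeMeasure, ← Measure.restrict_congr_set hcube]
  exact ae_restrict_mem (MeasurableSet.univ_pi fun _ => measurableSet_Ioo)

lemma integrable_mul_ofReal {P : (ι → ℝ) → ℂ} (hP : Continuous P) {F : (ι → ℝ) → ℝ}
    (hF : Integrable F (cubeMeasure ι)) : Integrable (fun y => P y * F y) (cubeMeasure ι) :=
  IntegrableOn.continuousOn_mul hP.continuousOn hF.ofReal isCompact_Icc

lemma tendsto_integral_prod_mul {F : (ι → ℝ) → ℝ} (hF : Integrable F (cubeMeasure ι))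
    {f : ι → ℕ → ℝ → ℂ} {a : ι → ℝ → ℂ} (hcont : ∀ j n, Continuous (f j n))
    (hlim : ∀ j, BoundedlyTendsto (f j) (a j)) :
    Tendsto (fun n => ∫ y, (∏ j, f j n (y j)) * (F y : ℂ) ∂(cubeMeasure ι)) atTop
      (𝓝 (∫ y, (∏ j, a j (y j)) * (F y : ℂ) ∂(cubeMeasure ι))) := by
  choose C hC using fun j => (hlim j).exists_bound
  refine tendsto_integral_of_dominated_convergence (fun y => (∏ j, C j) * ‖F y‖) (fun n => ?_)
    (hF.norm.const_mul _) (fun n => ?_) ?_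
  · exact (integrable_mul_ofReal (continuous_finsetProd _ fun j _ =>
      (hcont j n).comp (continuous_apply j)) hF).aestronglyMeasurable
  · filter_upwards [ae_mem_openCube] with y hy
    rw [norm_mul, norm_prod, Complex.norm_real]
    gcongr with j _
    exact hC j n _ (hy j (Set.mem_univ j))
  · filter_upwards [ae_mem_openCube] with y hy
    exact (tendsto_finsetProd _ fun j _ => (hlim j).tendsto _ (hy j (Set.mem_univ j))).mul_const _

lemma lineDeriv_comp_prod [DecidableEq ι] (L : ℂ →L[ℝ] ℝ) {ψ : ι → ℝ → ℂ} {i : ι}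
    (hψ : Differentiable ℝ (ψ i)) (y : ι → ℝ) :
    lineDeriv ℝ (fun y : ι → ℝ => L (∏ j, ψ j (y j))) y (Pi.single i 1) =
      L (∏ j, Function.update ψ i (deriv (ψ i)) j (y j)) := by
  have hline (t : ℝ) : ∏ j, ψ j ((y + t • Pi.single i 1 : ι → ℝ) j) =
      ψ i (y i + t) * ∏ j ∈ Finset.univ.erase i, ψ j (y j) := by
    rw [← Finset.mul_prod_erase _ _ (Finset.mem_univ i)]
    congr 1
    · simp
    · exact Finset.prod_congr rfl fun j hj => by simp [Finset.ne_of_mem_erase hj]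
  have hderiv : HasDerivAt (fun t => ψ i (y i + t)) (deriv (ψ i) (y i)) 0 :=
    HasDerivAt.comp_const_add _ _ (by simpa using (hψ (y i)).hasDerivAt)
  simp_rw [lineDeriv, hline]
  refine (L.hasFDerivAt.comp_hasDerivAt 0 (hderiv.mul_const _)).deriv.trans ?_
  rw [← Finset.mul_prod_erase _ _ (Finset.mem_univ i), Function.update_self]
  congr 2
  exact Finset.prod_congr rfl fun j hj => by
    rw [Function.update_of_ne (Finset.ne_of_mem_erase hj)]

lemma foldr_lineDeriv_comp_prod [DecidableEq ι] (L : ℂ →L[ℝ] ℝ) {φ : ι → ℝ → ℂ}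
    (hφ : ∀ j, Differentiable ℝ (φ j)) {l : List ι} (hl : l.Nodup) :
    l.foldr (fun j g y => lineDeriv ℝ g y (Pi.single j 1))
        (fun y : ι → ℝ => L (∏ j, φ j (y j))) =
      fun y => L (∏ j, (if j ∈ l then deriv (φ j) else φ j) (y j)) := by
  induction l with
  | nil => simp
  | cons i l ih =>
    rw [List.nodup_cons] at hl
    rw [List.foldr_cons, ih hl.2]
    funext y
    rw [lineDeriv_comp_prod L (ψ := fun j => if j ∈ l then deriv (φ j) else φ j)
      (by simpa only [if_neg hl.1] using hφ i)]
    congr 1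
    refine Finset.prod_congr rfl fun j _ => ?_
    rcases eq_or_ne j i with rfl | hji
    · simp [hl.1]
    · simp [hji]

lemma mixedPartial_comp_prod (L : ℂ →L[ℝ] ℝ) {φ : Fin s → ℝ → ℂ}
    (hφ : ∀ j, Differentiable ℝ (φ j)) (u : Finset (Fin s)) :
    mixedPartial u (fun y : Fin s → ℝ => L (∏ j, φ j (y j))) =
      fun y => L (∏ j, (if j ∈ u then deriv (φ j) else φ j) (y j)) := by
  rw [mixedPartial, foldr_lineDeriv_comp_prod L hφ (Finset.sort_nodup _ _)]
  simp only [Finset.mem_sort]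

lemma tsupport_prod_subset {φ : ι → ℝ → ℂ} :
    tsupport (fun y : ι → ℝ => ∏ j, φ j (y j)) ⊆ Set.univ.pi fun j => tsupport (φ j) :=
  closure_minimal
    (fun _ hy j _ => subset_tsupport _ fun hzero =>
      hy (Finset.prod_eq_zero (Finset.mem_univ j) hzero))
    (isClosed_set_pi fun _ _ => isClosed_tsupport _)

lemma IsWeakMixedDeriv.integral_mul_comp_prod (hg : IsWeakMixedDeriv F u g) (L : ℂ →L[ℝ] ℝ)
    {φ : Fin s → ℝ → ℂ} (hφ : ∀ j, IsTestFunction (φ j)) :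
    ∫ y, F y * L (∏ j, (if j ∈ u then deriv (φ j) else φ j) (y j)) ∂(cubeMeasure (Fin s)) =
      (-1) ^ u.card * ∫ y, g y * L (∏ j, φ j (y j)) ∂(cubeMeasure (Fin s)) := by
  set Φ : (Fin s → ℝ) → ℂ := fun y => ∏ j, φ j (y j)
  have hsmooth : ContDiff ℝ ∞ Φ :=
    contDiff_prod fun j _ => (hφ j).contDiff.comp (contDiff_apply ℝ ℝ j)
  have hcompact : HasCompactSupport Φ :=
    (isCompact_univ_pi fun j => (hφ j).hasCompactSupport).of_isClosed_subset
      (isClosed_tsupport _) tsupport_prod_subset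
  have hsupport : tsupport (fun y => L (Φ y)) ⊆ openCube (Fin s) :=
    (tsupport_comp_subset L.map_zero Φ).trans
      (tsupport_prod_subset.trans (Set.pi_mono fun j _ => (hφ j).tsupport_subset))
  rw [← hg.2 (fun y => L (Φ y)) (L.contDiff.comp hsmooth) (hcompact.comp_left L.map_zero)
    hsupport, mixedPartial_comp_prod L fun j => (hφ j).contDiff.differentiable (by simp)]

lemma clm_integral_mul_ofReal {P : (ι → ℝ) → ℂ} (hP : Continuous P) {F : (ι → ℝ) → ℝ}
    (hF : Integrable F (cubeMeasure ι)) (L : ℂ →L[ℝ] ℝ) :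
    L (∫ y, P y * (F y : ℂ) ∂(cubeMeasure ι)) = ∫ y, F y * L (P y) ∂(cubeMeasure ι) := by
  rw [← L.integral_comp_comm (integrable_mul_ofReal hP hF)]
  simp_rw [mul_comm (P _), ← Complex.real_smul, map_smul, smul_eq_mul]

lemma IsWeakMixedDeriv.integral_prod_mul (hg : IsWeakMixedDeriv F u g)
    (hF : Integrable F (cubeMeasure (Fin s))) {φ : Fin s → ℝ → ℂ}
    (hφ : ∀ j, IsTestFunction (φ j)) :
    ∫ y, (∏ j, (if j ∈ u then deriv (φ j) else φ j) (y j)) * (F y : ℂ) ∂(cubeMeasure (Fin s)) =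
      (-1 : ℝ) ^ u.card • ∫ y, (∏ j, φ j (y j)) * (g y : ℂ) ∂(cubeMeasure (Fin s)) := by
  have hφ_cont (j : Fin s) : Continuous (φ j) := (hφ j).contDiff.continuous
  have hderiv_cont (j : Fin s) : Continuous (if j ∈ u then deriv (φ j) else φ j) := by
    split_ifs
    · exact (hφ j).contDiff.continuous_deriv (by simp)
    · exact hφ_cont j
  have hclm (L : ℂ →L[ℝ] ℝ) :
      L (∫ y, (∏ j, (if j ∈ u then deriv (φ j) else φ j) (y j)) * (F y : ℂ)
        ∂(cubeMeasure (Fin s))) =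
      L ((-1 : ℝ) ^ u.card • ∫ y, (∏ j, φ j (y j)) * (g y : ℂ) ∂(cubeMeasure (Fin s))) := by
    rw [map_smul, smul_eq_mul, clm_integral_mul_ofReal (by fun_prop) hF,
      clm_integral_mul_ofReal (by fun_prop) (hg.1.integrable one_le_two),
      hg.integral_mul_comp_prod L hφ]
  exact Complex.ext (hclm Complex.reCLM) (hclm Complex.imCLM)

lemma IsWeakMixedDeriv.integral_prod_mul_of_hasTestApprox (hg : IsWeakMixedDeriv F u g)
    (hF : Integrable F (cubeMeasure (Fin s))) {a A : Fin s → ℝ → ℂ}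
    (ha : ∀ j, HasTestApprox (j ∈ u) (a j) (A j)) :
    ∫ y, (∏ j, a j (y j)) * (F y : ℂ) ∂(cubeMeasure (Fin s)) =
      (-1 : ℝ) ^ u.card • ∫ y, (∏ j, A j (y j)) * (g y : ℂ) ∂(cubeMeasure (Fin s)) := by
  choose φ hφ hA ha using ha
  have hderiv_cont (j : Fin s) (n : ℕ) :
      Continuous (if j ∈ u then deriv (φ j n) else φ j n) := by
    split_ifs
    · exact (hφ j n).contDiff.continuous_deriv (by simp)
    · exact (hφ j n).contDiff.continuous
  refine tendsto_nhds_unique (tendsto_integral_prod_mul hF hderiv_cont ha) ?_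
  simp_rw [fun n => hg.integral_prod_mul hF fun j => hφ j n]
  exact (tendsto_integral_prod_mul (hg.1.integrable one_le_two)
    (fun j n => (hφ j n).contDiff.continuous) hA).const_smul _

end IntegrationByParts

/-! ### The Fourier coefficients of functions with weak mixed derivatives -/

section FourierCoefficient

variable {s : ℕ} {F g : (Fin s → ℝ) → ℝ}

lemma norm_shiftedExp (n : ℤ) (t : ℝ) : ‖shiftedExp n t‖ = 1 := Circle.norm_coe _

lemma shiftedExp_zero : shiftedExp 0 = fun _ => 1 := funext fun t => by simp [shiftedExp]

lemma shiftedExp_neg_half (n : ℤ) : shiftedExp n (-(1 / 2)) = 1 := by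
  rw [shiftedExp, neg_add_cancel, AddCircle.coe_zero, fourier_eval_zero]

lemma shiftedExp_half (n : ℤ) : shiftedExp n (1 / 2) = 1 := by
  rw [shiftedExp, add_halves, AddCircle.coe_period, fourier_eval_zero]

lemma hasDerivAt_shiftedExp (n : ℤ) (t : ℝ) :
    HasDerivAt (shiftedExp n) (-2 * Real.pi * Complex.I * n * shiftedExp n t) t := by
  have hderiv := (hasDerivAt_fourier_neg 1 n (t + 1 / 2)).comp_add_const t (1 / 2)
  rwa [Complex.ofReal_one, div_one] at hderiv

lemma contDiff_shiftedExp (n : ℤ) : ContDiff ℝ ∞ (shiftedExp n) := by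
  refine contDiff_infty.2 fun k => ?_
  induction k with
  | zero => exact contDiff_zero.2 (continuous_shiftedExp n)
  | succ k ih =>
    rw [Nat.cast_succ, contDiff_succ_iff_deriv]
    refine ⟨fun t => (hasDerivAt_shiftedExp n t).differentiableAt, by simp, ?_⟩
    rw [funext fun t => (hasDerivAt_shiftedExp n t).deriv]
    exact contDiff_const.mul ih

/-- For `n ≠ 0`, the antiderivative of `shiftedExp n` vanishing at both end points of
`[-1/2, 1/2]`. -/
def antiExp (n : ℤ) (t : ℝ) : ℂ := (shiftedExp n t - 1) / (-2 * Real.pi * Complex.I * n)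

@[fun_prop]
lemma continuous_antiExp (n : ℤ) : Continuous (antiExp n) :=
  ((continuous_shiftedExp n).sub continuous_const).div_const _

lemma antiExp_neg_half (n : ℤ) : antiExp n (-(1 / 2)) = 0 := by
  rw [antiExp, shiftedExp_neg_half, sub_self, zero_div]

lemma antiExp_half (n : ℤ) : antiExp n (1 / 2) = 0 := by
  rw [antiExp, shiftedExp_half, sub_self, zero_div]

lemma hasDerivAt_antiExp {n : ℤ} (hn : n ≠ 0) (t : ℝ) :
    HasDerivAt (antiExp n) (shiftedExp n t) t := by
  have hne : -2 * Real.pi * Complex.I * n ≠ 0 := by simp [hn, Real.pi_ne_zero]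
  have hderiv :=
    ((hasDerivAt_shiftedExp n t).sub_const 1).div_const (-2 * Real.pi * Complex.I * n)
  rwa [mul_div_cancel_left₀ _ hne] at hderiv

lemma hasTestApprox_shiftedExp (h : Fin s → ℤ) (j : Fin s) :
    HasTestApprox (j ∈ freqSupport h) (shiftedExp (h j))
      fun t => if j ∈ freqSupport h then antiExp (h j) t else 1 := by
  by_cases hj : j ∈ freqSupport h
  · simp only [if_pos hj]
    exact hasTestApprox_of_hasDerivAt hj (contDiff_shiftedExp _)
      (hasDerivAt_antiExp (mem_freqSupport.1 hj)) (antiExp_neg_half _) (antiExp_half _)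
  · have hzero : h j = 0 := not_not.1 (mem_freqSupport.not.1 hj)
    simpa only [if_neg hj, hzero, shiftedExp_zero] using
      hasTestApprox_of_not hj (contDiff_shiftedExp (h j))

lemma IsWeakMixedDeriv.cubeFourierCoeff_eq {h : Fin s → ℤ}
    (hg : IsWeakMixedDeriv F (freqSupport h) g) (hF : Integrable F (cubeMeasure (Fin s))) :
    cubeFourierCoeff F h = (-1 : ℝ) ^ (freqSupport h).card •
      ∫ y, (∏ j, if j ∈ freqSupport h then antiExp (h j) (y j) else 1) * (g y : ℂ)
        ∂(cubeMeasure (Fin s)) := by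
  rw [cubeFourierCoeff]
  exact hg.integral_prod_mul_of_hasTestApprox hF (a := fun j => shiftedExp (h j))
    (A := fun j t => if j ∈ freqSupport h then antiExp (h j) t else 1)
    (hasTestApprox_shiftedExp h)

lemma measurePreserving_piEquivPiSubtypeProd_cubeMeasure (u : Finset (Fin s)) :
    MeasurePreserving (MeasurableEquiv.piEquivPiSubtypeProd (fun _ : Fin s => ℝ) (· ∈ u))
      (cubeMeasure (Fin s)) ((cubeMeasure {j // j ∈ u}).prod (cubeMeasure {j // j ∉ u})) := by
  simp only [cubeMeasure, cube, restrict_Icc_eq_pi]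
  convert! measurePreserving_piEquivPiSubtypeProd
    (fun _ : Fin s => (volume : Measure ℝ).restrict (Set.Icc (-(1 / 2)) (1 / 2))) (· ∈ u)

lemma measurePreserving_combine (u : Finset (Fin s)) :
    MeasurePreserving (fun p : ({j // j ∈ u} → ℝ) × ({j // j ∉ u} → ℝ) => combine u p.1 p.2)
      ((cubeMeasure {j // j ∈ u}).prod (cubeMeasure {j // j ∉ u})) (cubeMeasure (Fin s)) :=
  (measurePreserving_piEquivPiSubtypeProd_cubeMeasure u).symm

lemma integral_eq_integral_combine {E : Type*} [NormedAddCommGroup E] [NormedSpace ℝ E]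
    {G : (Fin s → ℝ) → E} (hG : Integrable G (cubeMeasure (Fin s))) (u : Finset (Fin s)) :
    ∫ y, G y ∂(cubeMeasure (Fin s)) =
      ∫ yu, ∫ yc, G (combine u yu yc) ∂(cubeMeasure {j // j ∉ u})
        ∂(cubeMeasure {j // j ∈ u}) :=
  ((measurePreserving_piEquivPiSubtypeProd_cubeMeasure u).symm.integral_comp' G).symm.trans
    (integral_prod _ ((measurePreserving_combine u).integrable_comp_of_integrable hG))

lemma integral_prod_mul_eq_integral_combine (hg : Integrable g (cubeMeasure (Fin s)))
    (u : Finset (Fin s)) {a : Fin s → ℝ → ℂ} (ha : ∀ j, Continuous (a j)) :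
    ∫ y, (∏ j, if j ∈ u then a j (y j) else 1) * (g y : ℂ) ∂(cubeMeasure (Fin s)) =
      ∫ yu, (∏ j : {j // j ∈ u}, a j (yu j)) *
        ((∫ yc, g (combine u yu yc) ∂(cubeMeasure {j // j ∉ u}) : ℝ) : ℂ)
          ∂(cubeMeasure {j // j ∈ u}) := by
  have hprod (yu : {j // j ∈ u} → ℝ) (yc : {j // j ∉ u} → ℝ) :
      (∏ j, if j ∈ u then a j (combine u yu yc j) else 1) = ∏ j : {j // j ∈ u}, a j (yu j) := by
    rw [Finset.prod_ite_mem, Finset.univ_inter, ← Finset.prod_attach]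
    exact Finset.prod_congr rfl fun j _ => by simp [combine, j.2]
  have hcont : Continuous fun y : Fin s → ℝ => ∏ j, if j ∈ u then a j (y j) else 1 :=
    continuous_finsetProd _ fun j _ => by split_ifs <;> fun_prop
  rw [integral_eq_integral_combine (integrable_mul_ofReal hcont hg) u]
  simp_rw [hprod, integral_const_mul, integral_complex_ofReal]

lemma norm_antiExp_sq (n : ℤ) (t : ℝ) :
    ‖antiExp n t‖ ^ 2 = (1 - (shiftedExp n t).re) / (2 * Real.pi ^ 2 * (n : ℝ) ^ 2) := by
  have hnumerator : ‖shiftedExp n t - 1‖ ^ 2 = 2 * (1 - (shiftedExp n t).re) := by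
    have hnorm := congrArg (· ^ 2) (norm_shiftedExp n t)
    simp only [← Complex.normSq_eq_norm_sq, Complex.normSq_apply, Complex.sub_re, Complex.sub_im,
      Complex.one_re, Complex.one_im] at hnorm ⊢
    linarith
  have hdenominator : ‖-2 * Real.pi * Complex.I * n‖ ^ 2 = 2 * (2 * Real.pi ^ 2 * (n : ℝ) ^ 2) := by
    simp only [norm_mul, norm_neg, Complex.norm_two, Complex.norm_real, Complex.norm_I,
      Complex.norm_intCast, mul_pow, Real.norm_eq_abs, sq_abs]
    ring
  rw [antiExp, norm_div, div_pow, hnumerator, hdenominator, mul_div_mul_left _ _ two_ne_zero]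

lemma integral_re_shiftedExp {n : ℤ} (hn : n ≠ 0) :
    ∫ t in (-(1 / 2) : ℝ)..(1 / 2), (shiftedExp n t).re = 0 := by
  rw [intervalIntegral.integral_eq_sub_of_hasDerivAt (f := fun t => (antiExp n t).re)
    (f' := fun t => (shiftedExp n t).re)
    (fun t _ => Complex.reCLM.hasFDerivAt.comp_hasDerivAt t (hasDerivAt_antiExp hn t))
    ((Complex.continuous_re.comp (continuous_shiftedExp n)).intervalIntegrable _ _)]
  rw [antiExp_half, antiExp_neg_half, sub_self]

lemma integral_norm_antiExp_sq {n : ℤ} (hn : n ≠ 0) :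
    ∫ t in Set.Icc (-(1 / 2) : ℝ) (1 / 2), ‖antiExp n t‖ ^ 2 =
      1 / (2 * Real.pi ^ 2) * (1 / (n : ℝ) ^ 2) := by
  have hint : IntervalIntegrable (fun t => (shiftedExp n t).re) volume (-(1 / 2)) (1 / 2) :=
    (Complex.continuous_re.comp (continuous_shiftedExp n)).intervalIntegrable _ _
  simp_rw [norm_antiExp_sq]
  rw [integral_Icc_eq_integral_Ioc, ← intervalIntegral.integral_of_le (by norm_num),
    intervalIntegral.integral_div, intervalIntegral.integral_sub intervalIntegrable_const hint,
    integral_re_shiftedExp hn, intervalIntegral.integral_const]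
  rw [sub_neg_eq_add, add_halves, one_smul, sub_zero, div_mul_div_comm, one_mul]

lemma lintegral_enorm_prod_antiExp_sq {κ : Type*} [Fintype κ] {n : κ → ℤ} (hn : ∀ j, n j ≠ 0) :
    ∫⁻ y, ‖∏ j, antiExp (n j) (y j)‖ₑ ^ 2 ∂(cubeMeasure κ) =
      ∏ j, (ENNReal.ofReal (1 / (2 * Real.pi ^ 2)) * freqDecay 2 (n j)) := by
  have henorm (y : κ → ℝ) : ‖∏ j, antiExp (n j) (y j)‖ₑ ^ 2 =
      ENNReal.ofReal (∏ j, ‖antiExp (n j) (y j)‖ ^ 2) := by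
    rw [Finset.prod_pow, ← norm_prod, ENNReal.ofReal_pow (norm_nonneg _), ofReal_norm]
  have hint : Integrable (fun y : κ → ℝ => ∏ j, ‖antiExp (n j) (y j)‖ ^ 2) (cubeMeasure κ) :=
    Continuous.integrableOn_Icc (continuous_finsetProd _ fun j _ => by fun_prop)
  simp_rw [henorm]
  rw [← ofReal_integral_eq_lintegral_ofReal hint
      (.of_forall fun y => Finset.prod_nonneg fun j _ => sq_nonneg _),
    cubeMeasure, cube, restrict_Icc_eq_pi,
    integral_fintype_prod_eq_prod (f := fun j t => ‖antiExp (n j) t‖ ^ 2),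
    ENNReal.ofReal_prod_of_nonneg fun j _ => integral_nonneg fun t => sq_nonneg _]
  refine Finset.prod_congr rfl fun j _ => ?_
  rw [integral_norm_antiExp_sq (hn j), freqDecay_of_ne_zero (hn j),
    ENNReal.ofReal_mul (by positivity), Real.rpow_two, sq_abs]

lemma enorm_integral_mul_sq_le {α 𝕜 : Type*} [RCLike 𝕜] [MeasurableSpace α] {μ : Measure α}
    {f g : α → 𝕜} (hf : AEStronglyMeasurable f μ) (hg : AEStronglyMeasurable g μ) :
    ‖∫ x, f x * g x ∂μ‖ₑ ^ 2 ≤ (∫⁻ x, ‖f x‖ₑ ^ 2 ∂μ) * ∫⁻ x, ‖g x‖ₑ ^ 2 ∂μ := by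
  have hholder :=
    ENNReal.lintegral_mul_le_Lp_mul_Lq μ Real.HolderConjugate.two_two hf.enorm hg.enorm
  simp only [Pi.mul_apply, ENNReal.rpow_two, ← enorm_mul, one_div] at hholder
  have hsqrt (x : ℝ≥0∞) : (x ^ (2⁻¹ : ℝ)) ^ 2 = x := by
    rw [← ENNReal.rpow_two, ENNReal.rpow_inv_rpow two_ne_zero]
  simpa only [mul_pow, hsqrt] using
    pow_le_pow_left' ((enorm_integral_le_lintegral_enorm _).trans hholder) 2

lemma IsWeakMixedDeriv.enorm_cubeFourierCoeff_sq_le {h : Fin s → ℤ}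
    (hg : IsWeakMixedDeriv F (freqSupport h) g) (hF : Integrable F (cubeMeasure (Fin s))) :
    ‖cubeFourierCoeff F h‖ₑ ^ 2 ≤
      (∏ j ∈ freqSupport h, (ENNReal.ofReal (1 / (2 * Real.pi ^ 2)) * freqDecay 2 (h j))) *
        ∫⁻ yu, ‖∫ yc, g (combine (freqSupport h) yu yc)
          ∂(cubeMeasure {j // j ∉ freqSupport h})‖ₑ ^ 2
            ∂(cubeMeasure {j // j ∈ freqSupport h}) := by
  have hg_int : Integrable g (cubeMeasure (Fin s)) := hg.1.integrable one_le_two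
  have hmean := ((measurePreserving_combine (freqSupport h)).integrable_comp_of_integrable
    hg_int).integral_prod_left.aestronglyMeasurable
  have hprod : Continuous fun yu : {j // j ∈ freqSupport h} → ℝ =>
      ∏ j : {j // j ∈ freqSupport h}, antiExp (h j) (yu j) :=
    continuous_finsetProd _ fun j _ => by fun_prop
  have hcauchy := enorm_integral_mul_sq_le hprod.aestronglyMeasurable
    (Complex.continuous_ofReal.comp_aestronglyMeasurable hmean)
  have henorm (x : ℝ) : ‖(x : ℂ)‖ₑ = ‖x‖ₑ := by
    rw [← ofReal_norm, ← ofReal_norm, Complex.norm_real]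
  rw [lintegral_enorm_prod_antiExp_sq fun j => mem_freqSupport.1 j.2] at hcauchy
  rw [hg.cubeFourierCoeff_eq hF, enorm_smul, enorm_pow, enorm_neg, enorm_one, one_pow, one_mul,
    integral_prod_mul_eq_integral_combine hg_int _ fun j => continuous_antiExp (h j),
    ← Finset.prod_coe_sort]
  simpa only [Function.comp_apply, henorm] using hcauchy

end FourierCoefficient

/-! ### The outcomes of the construction -/

section Outcome

lemma exists_forall_of_forall_exists_update {ι κ : Type*} [LinearOrder ι] [Finite ι] [Nonempty κ]
    {P : (ι → κ) → ι → Prop} (hcongr : ∀ z z' j, (∀ i ≤ j, z i = z' i) → P z j → P z' j)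
    (hupdate : ∀ z j, ∃ x, P (Function.update z j x) j) : ∃ z, ∀ j, P z j := by
  have := Fintype.ofFinite ι
  suffices hsub : ∀ S : Finset ι, ∃ z, ∀ j ∈ S, P z j by simpa using hsub Finset.univ
  intro S
  induction S using Finset.induction_on_max with
  | empty => exact ⟨fun _ => Classical.arbitrary κ, by simp⟩
  | insert k S hk ih =>
    obtain ⟨z, hz⟩ := ih
    obtain ⟨x, hx⟩ := hupdate z k
    refine ⟨Function.update z k x, (Finset.forall_mem_insert ..).2 ⟨hx, fun j hj => ?_⟩⟩
    refine hcongr z _ j (fun i hi => ?_) (hz j hj)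
    exact (Function.update_of_ne (hi.trans_lt (hk j hj)).ne x z).symm

variable {s : ℕ} {b m : ℕ} {w : Fin s → ℕ} {α : ℝ} {γ : Finset (Fin s) → ℝ} {z : Fin s → ℕ}
  {j : Fin s}

lemma prefixErrorSq_congr (α : ℝ) (γ : Finset (Fin s) → ℝ) (N : ℕ) {v v' : Fin s → ℕ}
    (h : ∀ i ≤ j, v i = v' i) : prefixErrorSq α γ N v j = prefixErrorSq α γ N v' j := by
  rw [prefixErrorSq, prefixErrorSq,
    funext fun i => h (Fin.castLE j.isLt i) (Fin.le_def.2 (Nat.lt_succ_iff.1 i.isLt))]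

/-- The condition that `IsOutcome` imposes on the component `j`, given the preceding ones. -/
structure IsSelectedAt (b m : ℕ) (w : Fin s → ℕ) (α : ℝ) (γ : Finset (Fin s) → ℝ)
    (z : Fin s → ℕ) (j : Fin s) : Prop where
  eq_zero : m ≤ w j → z j = 0
  mem_units : w j < m → z j ∈ unitsMod (b ^ (m - w j))
  minimal : w j < m → ∀ x ∈ unitsMod (b ^ (m - w j)),
    prefixErrorSq α γ (b ^ m) (genVector b w z) j ≤
      prefixErrorSq α γ (b ^ m) (genVector b w (Function.update z j x)) j

lemma IsSelectedAt.congr {z' : Fin s → ℕ} (h : ∀ i ≤ j, z i = z' i)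
    (hz : IsSelectedAt b m w α γ z j) : IsSelectedAt b m w α γ z' j where
  eq_zero hw := h j le_rfl ▸ hz.eq_zero hw
  mem_units hw := h j le_rfl ▸ hz.mem_units hw
  minimal hw x hx := by
    refine le_of_eq_of_le (prefixErrorSq_congr α γ _ fun i hi => ?_) <|
      (hz.minimal hw x hx).trans_eq (prefixErrorSq_congr α γ _ fun i hi => ?_)
    · rw [genVector, genVector, h i hi]
    · rcases eq_or_ne i j with rfl | hij
      · simp only [genVector, Function.update_self]
      · simp only [genVector, Function.update_of_ne hij, h i hi]

lemma exists_isSelectedAt_update (hb : 0 < b) (m : ℕ) (w : Fin s → ℕ) (α : ℝ)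
    (γ : Finset (Fin s) → ℝ) (z : Fin s → ℕ) (j : Fin s) :
    ∃ x, IsSelectedAt b m w α γ (Function.update z j x) j := by
  rcases lt_or_ge (w j) m with hw | hw
  · obtain ⟨x, hx, hmin⟩ := (unitsMod (b ^ (m - w j))).exists_min_image
      (fun x => prefixErrorSq α γ (b ^ m) (genVector b w (Function.update z j x)) j)
      (unitsMod_nonempty (Nat.pow_pos hb))
    exact ⟨x, fun h => absurd h hw.not_ge, fun _ => by rwa [Function.update_self],
      fun _ y hy => by rw [Function.update_idem]; exact hmin y hy⟩
  · exact ⟨0, fun _ => Function.update_self .., fun h => absurd h hw.not_gt,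
      fun h => absurd h hw.not_gt⟩

lemma exists_isOutcome (hb : 0 < b) (m : ℕ) (w : Fin s → ℕ) (α : ℝ) (γ : Finset (Fin s) → ℝ) :
    ∃ z, IsOutcome b m w α γ z := by
  obtain ⟨z, hz⟩ := exists_forall_of_forall_exists_update
    (fun _ _ _ h hz => IsSelectedAt.congr h hz) (exists_isSelectedAt_update hb m w α γ)
  exact ⟨z, fun j => (hz j).eq_zero, fun j => (hz j).mem_units, fun j => (hz j).minimal⟩

end Outcome

/-! ### The error bound -/

section ErrorBound

variable {s : ℕ} {F : (Fin s → ℝ) → ℝ} {γ : Finset (Fin s) → ℝ}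

/-- The contribution of `∂^{|u|} F / ∂ y_u` to the squared Sobolev norm, before division by the
weight `γ u`. -/
def sobolevTerm (F : (Fin s → ℝ) → ℝ) (u : Finset (Fin s)) : ℝ≥0∞ :=
  ∫⁻ yu, ‖∫ yc, weakMixedDeriv F u (combine u yu yc) ∂(cubeMeasure {j // j ∉ u})‖ₑ ^ 2
    ∂(cubeMeasure {j // j ∈ u})

lemma sobolevNorm_sq (γ : Finset (Fin s) → ℝ) (F : (Fin s → ℝ) → ℝ) :
    sobolevNorm γ F ^ 2 = ∑ u, (ENNReal.ofReal (γ u))⁻¹ * sobolevTerm F u := by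
  rw [sobolevNorm, one_div, ← ENNReal.rpow_two, ENNReal.rpow_inv_rpow two_ne_zero]
  rfl

lemma sobolevTerm_le (hF : sobolevNorm γ F ≠ ⊤) (u : Finset (Fin s)) :
    sobolevTerm F u ≤ ENNReal.ofReal (γ u) * sobolevNorm γ F ^ 2 := by
  have hle : (ENNReal.ofReal (γ u))⁻¹ * sobolevTerm F u ≤ sobolevNorm γ F ^ 2 := by
    rw [sobolevNorm_sq]
    exact Finset.single_le_sum (f := fun u => (ENNReal.ofReal (γ u))⁻¹ * sobolevTerm F u)
      (fun _ _ => zero_le) (Finset.mem_univ u)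
  refine (le_mul_inv_mul ENNReal.ofReal_ne_top ?_).trans (by gcongr)
  exact ne_top_of_le_ne_top (ENNReal.pow_ne_top hF) hle

lemma isWeakMixedDeriv_weakMixedDeriv {u : Finset (Fin s)} (h : ∃ g, IsWeakMixedDeriv F u g) :
    IsWeakMixedDeriv F u (weakMixedDeriv F u) := by
  rw [weakMixedDeriv, dif_pos h]
  exact h.choose_spec

lemma freqWeight_korobovWeights (hγ : ∀ u, 0 ≤ γ u) (h : Fin s → ℤ) :
    freqWeight 2 (korobovWeights γ) h = ENNReal.ofReal (γ (freqSupport h)) *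
      ∏ j ∈ freqSupport h, (ENNReal.ofReal (1 / (2 * Real.pi ^ 2)) * freqDecay 2 (h j)) := by
  rw [freqWeight, korobovWeights, Finset.prod_mul_distrib, Finset.prod_const, ← mul_assoc,
    ← ENNReal.ofReal_pow (by positivity), ← ENNReal.ofReal_mul (hγ _), one_div, inv_pow,
    ← div_eq_mul_inv]

lemma enorm_cubeFourierCoeff_sq_le (hγ : ∀ u, 0 ≤ γ u) (hF : MemSobolev γ F) (h : Fin s → ℤ) :
    ‖cubeFourierCoeff F h‖ₑ ^ 2 ≤ freqWeight 2 (korobovWeights γ) h * sobolevNorm γ F ^ 2 := by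
  obtain ⟨hF2, hweak, hfin⟩ := hF
  refine ((isWeakMixedDeriv_weakMixedDeriv (hweak _)).enorm_cubeFourierCoeff_sq_le
    (hF2.integrable one_le_two)).trans ?_
  rw [freqWeight_korobovWeights hγ, mul_comm (ENNReal.ofReal _), mul_assoc]
  gcongr
  exact sobolevTerm_le hfin.ne _

lemma ofReal_integral_sqError_le (hγ : ∀ u, 0 ≤ γ u) (hF : MemSobolev γ F) {N : ℕ} (hN : 0 < N)
    (z : Fin s → ℕ) :
    ENNReal.ofReal (∫ Δ in Set.Icc (0 : Fin s → ℝ) 1, sqError N z F Δ) ≤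
      dualSum 2 (korobovWeights γ) N z {h | h ≠ 0} * sobolevNorm γ F ^ 2 := by
  rw [ofReal_integral_sqError hF.1 hN z, dualSum, ← ENNReal.tsum_mul_right]
  exact ENNReal.tsum_le_tsum fun h => enorm_cubeFourierCoeff_sq_le hγ hF h

lemma ofReal_rmse_le (hγ : ∀ u, 0 ≤ γ u) (hF : MemSobolev γ F) {N : ℕ} (hN : 0 < N)
    (z : Fin s → ℕ) :
    ENNReal.ofReal (rmse N z F) ≤
      dualSum 2 (korobovWeights γ) N z {h | h ≠ 0} ^ (1 / 2 : ℝ) * sobolevNorm γ F := by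
  have hnonneg : 0 ≤ ∫ Δ in Set.Icc (0 : Fin s → ℝ) 1, sqError N z F Δ :=
    integral_nonneg fun Δ => sq_nonneg _
  have hsqrt : (sobolevNorm γ F ^ 2) ^ (1 / 2 : ℝ) = sobolevNorm γ F := by
    rw [← ENNReal.rpow_two, one_div, ENNReal.rpow_rpow_inv two_ne_zero]
  rw [rmse, Real.sqrt_eq_rpow, ← ENNReal.ofReal_rpow_of_nonneg hnonneg one_half_pos.le]
  refine (ENNReal.rpow_le_rpow (ofReal_integral_sqError_le hγ hF hN z) one_half_pos.le).trans_eq ?_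
  rw [ENNReal.mul_rpow_of_nonneg _ _ one_half_pos.le, hsqrt]

lemma rmse_le_of_dualSum_rpow_le (hγ : ∀ u, 0 ≤ γ u) (hF : MemSobolev γ F) {N : ℕ} (hN : 0 < N)
    {z : Fin s → ℕ} {lam X : ℝ} (hlam : 0 < lam) (hX : 0 ≤ X)
    (hsum : dualSum 2 (korobovWeights γ) N z {h | h ≠ 0} ^ lam ≤ ENNReal.ofReal X) :
    rmse N z F ≤ X ^ (1 / (2 * lam)) * (sobolevNorm γ F).toReal := by
  have hexp : lam * (1 / (2 * lam)) = 1 / 2 := by field_simp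
  rw [← ENNReal.ofReal_le_ofReal_iff (by positivity), ENNReal.ofReal_mul (by positivity),
    ENNReal.ofReal_toReal hF.2.2.ne, ← ENNReal.ofReal_rpow_of_nonneg hX (by positivity)]
  refine (ofReal_rmse_le hγ hF hN z).trans ?_
  rw [← hexp, ENNReal.rpow_mul]
  gcongr

lemma rho_nonneg {lam : ℝ} (hlam : 1 / 2 < lam) : 0 ≤ rho lam :=
  mul_nonneg (mul_nonneg zero_le_two (riemannZeta_re_nonneg (by linarith))) (by positivity)

lemma ofReal_korobovWeights_rpow_mul (hγ : ∀ u, 0 ≤ γ u) {lam : ℝ} (hlam : 1 / 2 < lam)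
    (u : Finset (Fin s)) :
    ENNReal.ofReal (korobovWeights γ u) ^ lam * (∑' k, freqDecay (2 * lam) k) ^ u.card =
      ENNReal.ofReal (γ u ^ lam * rho lam ^ u.card) := by
  have hzeta : 0 ≤ (riemannZeta (2 * lam : ℝ)).re := riemannZeta_re_nonneg (by linarith)
  have hweight : 0 ≤ korobovWeights γ u := div_nonneg (hγ u) (by positivity)
  have hpow : ((2 * Real.pi ^ 2) ^ u.card) ^ lam = ((2 * Real.pi ^ 2) ^ lam) ^ u.card :=
    (Real.rpow_pow_comm (by positivity) lam u.card).symm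
  rw [tsum_freqDecay (by linarith), ENNReal.ofReal_rpow_of_nonneg hweight (by linarith),
    ← ENNReal.ofReal_pow (by positivity), ← ENNReal.ofReal_mul (by positivity), korobovWeights,
    rho, Real.div_rpow (hγ u) (by positivity), hpow, mul_pow _ (_ ^ (-lam)),
    Real.rpow_neg (by positivity), inv_pow, div_mul_eq_mul_div, mul_div_assoc, div_eq_mul_inv]

/-- The sum over the nonempty coordinate sets in the error bound for the reduced construction. -/
def reducedWeightSum (b m : ℕ) (w : Fin s → ℕ) (γ : Finset (Fin s) → ℝ) (lam : ℝ) : ℝ :=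
  ∑ u : Finset (Fin s) with u.Nonempty, γ u ^ lam * rho lam ^ u.card * (b : ℝ) ^ min m (u.sup w)

lemma reducedWeightTerm_nonneg (hγ : ∀ u, 0 ≤ γ u) {lam : ℝ} (hlam : 1 / 2 < lam) (b m : ℕ)
    (w : Fin s → ℕ) (u : Finset (Fin s)) :
    0 ≤ γ u ^ lam * rho lam ^ u.card * (b : ℝ) ^ min m (u.sup w) := by
  have := rho_nonneg hlam
  have := hγ u
  positivity

lemma reducedWeightSum_nonneg (hγ : ∀ u, 0 ≤ γ u) {lam : ℝ} (hlam : 1 / 2 < lam) (b m : ℕ)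
    (w : Fin s → ℕ) : 0 ≤ reducedWeightSum b m w γ lam :=
  Finset.sum_nonneg fun u _ => reducedWeightTerm_nonneg hγ hlam b m w u

lemma ofReal_reducedWeightSum (hγ : ∀ u, 0 ≤ γ u) {lam : ℝ} (hlam : 1 / 2 < lam) (b m : ℕ)
    (w : Fin s → ℕ) :
    ENNReal.ofReal (reducedWeightSum b m w γ lam) =
      ∑ u : Finset (Fin s) with u.Nonempty, ENNReal.ofReal (korobovWeights γ u) ^ lam *
        (∑' k, freqDecay (2 * lam) k) ^ u.card * (b : ℝ≥0∞) ^ min m (u.sup w) := by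
  rw [reducedWeightSum,
    ENNReal.ofReal_sum_of_nonneg fun u _ => reducedWeightTerm_nonneg hγ hlam b m w u]
  refine Finset.sum_congr rfl fun u _ => ?_
  rw [ofReal_korobovWeights_rpow_mul hγ hlam, ENNReal.ofReal_mul' (by positivity),
    ENNReal.ofReal_pow b.cast_nonneg, ENNReal.ofReal_natCast]

lemma IsOutcome.dualSum_rpow_le {b m : ℕ} {w z : Fin s → ℕ}
    (hz : IsOutcome b m w 2 (korobovWeights γ) z) (hb : 0 < b) {C : ℝ}
    (hC : (b : ℝ) ≤ C * b.totient) (hγ : ∀ u, 0 ≤ γ u) {lam : ℝ} (hlam : 1 / 2 < lam)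
    (hlam1 : lam ≤ 1) :
    dualSum 2 (korobovWeights γ) (b ^ m) (genVector b w z) {h | h ≠ 0} ^ lam ≤
      ENNReal.ofReal (reducedWeightSum b m w γ lam * (C / ((b ^ m : ℕ) : ℝ))) := by
  have hN : 0 < b ^ m := Nat.pow_pos hb
  have hC' : (b : ℝ≥0∞) ≤ ENNReal.ofReal C * b.totient := by
    rw [← ENNReal.ofReal_natCast, ← ENNReal.ofReal_natCast,
      ← ENNReal.ofReal_mul' (Nat.cast_nonneg _)]
    exact ENNReal.ofReal_le_ofReal hC
  refine (ReducedCBC.dualSum_rpow_le hb hC' hz.eq_zero (korobovWeights γ) one_lt_two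
    (by linarith) hlam1 (by linarith) fun d hd x hx => ?_).trans_eq ?_
  · rw [← prefixErrorSq_eq one_lt_two _ hN, ← prefixErrorSq_eq one_lt_two _ hN]
    exact hz.minimal d hd x hx
  · rw [ENNReal.ofReal_mul (reducedWeightSum_nonneg hγ hlam b m w),
      ofReal_reducedWeightSum hγ hlam, ENNReal.ofReal_div_of_pos (Nat.cast_pos.2 hN),
      ENNReal.ofReal_natCast, Nat.cast_pow]

end ErrorBound

end ReducedCBC

end

theorem theorem3_general (b : ℕ) (hb : 0 < b) (m s : ℕ) (w : Fin s → ℕ)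
    (γ : Finset (Fin s) → ℝ) (hγ : ∀ u, 0 ≤ γ u) (C : ℝ) (hC : (b : ℝ) ≤ C * b.totient) :
    (∃ z : Fin s → ℕ, ReducedCBC.IsOutcome b m w 2 (ReducedCBC.korobovWeights γ) z) ∧
    ∀ z : Fin s → ℕ, ReducedCBC.IsOutcome b m w 2 (ReducedCBC.korobovWeights γ) z →
      ∀ F : (Fin s → ℝ) → ℝ, ReducedCBC.MemSobolev γ F →
        IntegrableOn (ReducedCBC.sqError (b ^ m) (ReducedCBC.genVector b w z) F)
          (Set.Icc (0 : Fin s → ℝ) 1) ∧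
        ∀ lam : ℝ, 1 / 2 < lam → lam ≤ 1 →
          ReducedCBC.rmse (b ^ m) (ReducedCBC.genVector b w z) F ≤
            (∑ u : Finset (Fin s) with u.Nonempty,
              γ u ^ lam * ReducedCBC.rho lam ^ u.card * (b : ℝ) ^ min m (u.sup w)) ^
                (1 / (2 * lam)) *
              (C / ((b ^ m : ℕ) : ℝ)) ^ (1 / (2 * lam)) *
              (ReducedCBC.sobolevNorm γ F).toReal := by
  refine ⟨ReducedCBC.exists_isOutcome hb m w _ _, fun z hz F hF =>
    ⟨ReducedCBC.integrableOn_sqError hF.1 _ _, fun lam hlam hlam1 => ?_⟩⟩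
  have hsum := ReducedCBC.reducedWeightSum_nonneg hγ hlam b m w
  have hC0 : 0 ≤ C := nonneg_of_mul_nonneg_left (b.cast_nonneg.trans hC)
    (Nat.cast_pos.2 (Nat.totient_pos.2 hb))
  have hratio : 0 ≤ C / ((b ^ m : ℕ) : ℝ) := div_nonneg hC0 (Nat.cast_nonneg _)
  have hbound := ReducedCBC.rmse_le_of_dualSum_rpow_le hγ hF (Nat.pow_pos hb) (by linarith)
    (mul_nonneg hsum hratio) (hz.dualSum_rpow_le hb hC hγ hlam hlam1)
  rwa [Real.mul_rpow hsum hratio] at hbound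

theorem theorem3 (b : ℕ) (hb : b.Prime) (m s : ℕ) (w : Fin s → ℕ) (hw : Monotone w)
    (γ : Finset (Fin s) → ℝ) (hγ : ∀ u, 0 ≤ γ u) :
    (∃ z : Fin s → ℕ, ReducedCBC.IsOutcome b m w 2 (ReducedCBC.korobovWeights γ) z) ∧
    ∀ z : Fin s → ℕ, ReducedCBC.IsOutcome b m w 2 (ReducedCBC.korobovWeights γ) z →
      ∀ F : (Fin s → ℝ) → ℝ, ReducedCBC.MemSobolev γ F →
        IntegrableOn (ReducedCBC.sqError (b ^ m) (ReducedCBC.genVector b w z) F)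
          (Set.Icc (0 : Fin s → ℝ) 1) ∧
        ∀ lam : ℝ, 1 / 2 < lam → lam ≤ 1 →
          ReducedCBC.rmse (b ^ m) (ReducedCBC.genVector b w z) F ≤
            (∑ u : Finset (Fin s) with u.Nonempty,
              γ u ^ lam * ReducedCBC.rho lam ^ u.card * (b : ℝ) ^ min m (u.sup w)) ^
                (1 / (2 * lam)) *
              (2 / ((b ^ m : ℕ) : ℝ)) ^ (1 / (2 * lam)) *
              (ReducedCBC.sobolevNorm γ F).toReal :=
  theorem3_general b hb.pos m s w γ hγ 2
    (by exact_mod_cast ReducedCBC.le_two_mul_totient_of_prime hb)
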